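/- Let $k$ be an algebraically closed field of characteristic $p\ge 3$, and let $\mathfrak n$ be a finite-dimensional restricted Lie algebra over $k$ that is $p$-nilpotent, i.e. there is $N\ge 0$ with $x^{[p]^N}=0$ for all $x\in\mathfrak n$ (for instance, $x^{[p]}=0$ for all $x$). Let $u(\mathfrak n)=U(\mathfrak n)/(x^p-x^{[p]}:x\in\mathfrak n)$ be the restricted enveloping algebra, $\operatorname{H}^*(u(\mathfrak n),k)$ its cohomology ring, $\operatorname{H}^*(\mathfrak n,k)$ the ordinary Lie algebra cohomology ring, and $\phi:\operatorname{H}^*(u(\mathfrak n),k)\to\operatorname{H}^*(\mathfrak n,k)$ the homomorphism of $k$-algebras induced by $U(\mathfrak n)\to u(\mathfrak n)$ (an edge homomorphism of the spectral sequence $S^i(\mathfrak n^*)^{(1)}\otimes \operatorname{H}^j(\mathfrak n,k)\Rightarrow \operatorname{H}^{2i+j}(u(\mathfrak n),k)$). Let $S=S^*(\mathfrak n^*)^{(1)}$ be the symmetric algebra on the space $(\mathfrak n^*)^{(1)}$ of Frobenius-semilinear functions $\mathfrak n\to k$, and regard $\operatorname{H}^*(u(\mathfrak n),k)$ as an $S$-algebra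 through the other edge homomorphism $\Phi:S\to \operatorname{H}^{2*}(u(\mathfrak n),k)$. This is the homomorphism of $k$-algebras that sends $f\in(\mathfrak n^*)^{(1)}$ to its transgression: if $\Lambda$ is a linear form on $U(\mathfrak n)$ with $\Lambda(x^p-x^{[p]})=f(x)$ for all $x\in\mathfrak n$ that vanishes on $U^+I$, where $U^+$ is the augmentation ideal of $U(\mathfrak n)$ and $I=\ker(U(\mathfrak n)\to u(\mathfrak n))$, then $\Phi(f)$ is the class of the bar cocycle $(\bar a,\bar b)\mapsto-\Lambda(ab)$ $(a,b\in U^+)$. Suppose that there is an isomorphism of $S$-modules $\operatorname{H}^*(u(\mathfrak n),k)\cong S\otimes_k \operatorname{H}^*(\mathfrak n,k)$, and that there is a $k$-subalgebra $B$ of $\operatorname{H}^*(u(\mathfrak n),k)$ that $\phi$ maps bijectively onto $\operatorname{H}^*(\mathfrak n,k)$. Then there is an isomorphism of rings $S\otimes_k \operatorname{H}^*(\mathfrak n,k)\cong \operatorname{H}^*(u(\mathfrak n),k)$; more precisely, there is an isomorphism of $S$-algebras that maps $S^i(\mathfrak n^*)^{(1)}\otimes \operatorname{H}^j(\mathfrak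 n,k)$ into $\operatorname{H}^{2i+j}(u(\mathfrak n),k)$ for all $i,j\ge 0$. -/

import Mathlib

open scoped TensorProduct

noncomputable section

namespace RestrictedCohomology

/-! ### Differential graded algebras and their cohomology rings -/

/-- A differential on a `k`-algebra `C`: a sign involution `sgn` (which is `(-1)^m` on the elements
of degree `m`) and a square-zero antiderivation `d` that is odd for it. -/
structure Differential (k : Type*) [Field k] (C : Type*) [Ring C] [Algebra k C] where
  sgn : C →ₐ[k] C
  d : C →ₗ[k] C
  sgn_sgn : ∀ x, sgn (sgn x) = x
  d_sgn : ∀ x, d (sgn x) = -sgn (d x)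
  d_mul : ∀ x y, d (x * y) = d x * y + sgn x * d y
  d_d : ∀ x, d (d x) = 0

namespace Differential

variable {k : Type*} [Field k] {C : Type*} [Ring C] [Algebra k C] (D : Differential k C)

theorem d_one : D.d 1 = 0 := by
  have h := D.d_mul 1 1
  simpa using h

/-- The algebra of cocycles, the kernel of `d`. -/
def cocycles : Subalgebra k C where
  carrier := {x | D.d x = 0}
  mul_mem' := by
    intro x y hx hy
    simp only [Set.mem_ofPred_eq] at *
    rw [D.d_mul, hx, hy]; simp
  add_mem' := by
    intro x y hx hy
    simp only [Set.mem_ofPred_eq] at *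
    rw [map_add, hx, hy, add_zero]
  algebraMap_mem' := by
    intro r
    simp only [Set.mem_ofPred_eq, Algebra.algebraMap_eq_smul_one, map_smul, D.d_one, smul_zero]

theorem mem_cocycles {x : C} : x ∈ D.cocycles ↔ D.d x = 0 := Iff.rfl

/-- The coboundaries, the image of `d`, as an ideal of the algebra of cocycles. -/
def coboundaries : Ideal D.cocycles where
  carrier := {z | ∃ y, D.d y = (z : C)}
  zero_mem' := ⟨0, by simp⟩
  add_mem' := by
    rintro x y ⟨a, ha⟩ ⟨b, hb⟩
    exact ⟨a + b, by simp [ha, hb]⟩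
  smul_mem' := by
    rintro z x ⟨a, ha⟩
    refine ⟨D.sgn z * a, ?_⟩
    have hz : D.d (z : C) = 0 := z.2
    rw [D.d_mul, D.d_sgn, hz, D.sgn_sgn, ha]
    simp

theorem mem_coboundaries {z : D.cocycles} : z ∈ D.coboundaries ↔ ∃ y, D.d y = (z : C) := Iff.rfl

instance : D.coboundaries.IsTwoSided where
  mul_mem_of_left := by
    rintro x z ⟨a, ha⟩
    refine ⟨a * z, ?_⟩
    have hz : D.d (z : C) = 0 := z.2
    rw [D.d_mul, hz, ha]
    simp

/-- The cohomology ring: cocycles modulo coboundaries. -/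
abbrev Cohomology : Type _ := D.cocycles ⧸ D.coboundaries

/-- The cohomology class of a cocycle. -/
def cls : D.cocycles →ₐ[k] D.Cohomology := Ideal.Quotient.mkₐ k D.coboundaries

theorem cls_surjective : Function.Surjective D.cls := Ideal.Quotient.mkₐ_surjective k _

theorem cls_eq_cls {x y : D.cocycles} : D.cls x = D.cls y ↔ ∃ z, D.d z = (x : C) - y := by
  change Ideal.Quotient.mk _ x = Ideal.Quotient.mk _ y ↔ _
  rw [Ideal.Quotient.eq, mem_coboundaries]
  simp

/-- If `C` is generated as an algebra by the subspace `G` of elements of degree one, so that `G ^ m`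
is the space of elements of degree `m`, this is the space of classes of degree `m`. -/
def degreePart (G : Submodule k C) (m : ℕ) : Submodule k D.Cohomology :=
  ((G ^ m).comap D.cocycles.val.toLinearMap).map D.cls.toLinearMap

/-- The homomorphism of cohomology rings induced by a homomorphism of algebras that commutes with
the differentials. -/
def mapCohomology {C' : Type*} [Ring C'] [Algebra k C'] (D' : Differential k C')
    (θ : C →ₐ[k] C') (h : ∀ x, θ (D.d x) = D'.d (θ x)) : D.Cohomology →ₐ[k] D'.Cohomology :=
  Ideal.Quotient.liftₐ D.coboundaries
    (D'.cls.comp ((θ.comp D.cocycles.val).codRestrict D'.cocycles (fun z => by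
      have hz : D.d (z : C) = 0 := z.2
      change D'.d (θ z) = 0
      rw [← h, hz, map_zero])))
    (by
      rintro z ⟨y, hy⟩
      change D'.cls _ = 0
      rw [← map_zero D'.cls, cls_eq_cls]
      exact ⟨θ y, by rw [← h, hy]; simp⟩)

end Differential

/-! ### Antiderivations of tensor algebras and exterior algebras -/

section Antiderivation

variable {k : Type*} [Field k]

/-- Two maps that satisfy the same twisted Leibniz rule agree if they agree on generators. -/
theorem eq_of_adjoin {C : Type*} [Ring C] [Algebra k C] {G : Set C}
    (hG : Algebra.adjoin k G = ⊤) (s t : C →ₐ[k] C) (f g : C →ₗ[k] C)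
    (hf : ∀ x y, f (x * y) = f x * t y + s x * f y)
    (hg : ∀ x y, g (x * y) = g x * t y + s x * g y)
    (h : ∀ x ∈ G, f x = g x) (x : C) : f x = g x := by
  have hx : x ∈ Algebra.adjoin k G := by rw [hG]; trivial
  have f1 : f 1 = 0 := by simpa using hf 1 1
  have g1 : g 1 = 0 := by simpa using hg 1 1
  induction hx using Algebra.adjoin_induction with
  | mem x hx => exact h x hx
  | algebraMap r => simp [Algebra.algebraMap_eq_smul_one, f1, g1]
  | add x y _ _ hx hy => rw [map_add, map_add, hx, hy]
  | mul x y _ _ hx hy => rw [hf, hg, hx, hy]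

/-- The matrices `(-u v, δ v; 0, u v)`. A homomorphism of algebras into the matrices whose upper
right corner is a twisted derivation is determined by such matrices. -/
def cornerMatrix {V C : Type*} [AddCommGroup V] [Module k V] [Ring C] [Algebra k C]
    (u δ : V →ₗ[k] C) : V →ₗ[k] Matrix (Fin 2) (Fin 2) C where
  toFun v := !![-u v, δ v; 0, u v]
  map_add' v w := by
    ext i j; fin_cases i <;> fin_cases j <;> simp [add_comm]
  map_smul' r v := by
    ext i j; fin_cases i <;> fin_cases j <;> simp

theorem corner_of_adjoin {C : Type*} [Ring C] [Algebra k C] {G : Set C}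
    (hG : Algebra.adjoin k G = ⊤) (Θ : C →ₐ[k] Matrix (Fin 2) (Fin 2) C) (s : C →ₐ[k] C)
    (h : ∀ x ∈ G, Θ x 1 0 = 0 ∧ Θ x 1 1 = x ∧ Θ x 0 0 = s x) (x : C) :
    Θ x 1 0 = 0 ∧ Θ x 1 1 = x ∧ Θ x 0 0 = s x := by
  have hx : x ∈ Algebra.adjoin k G := by rw [hG]; trivial
  induction hx using Algebra.adjoin_induction with
  | mem x hx => exact h x hx
  | algebraMap r => simp [Matrix.algebraMap_eq_diagonal]
  | add x y _ _ hx hy => simp [hx, hy]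
  | mul x y _ _ hx hy =>
    simp only [map_mul, Matrix.mul_apply, Fin.sum_univ_two]
    simp [hx, hy]

/-- The upper right corner. -/
def corner {C : Type*} [Ring C] [Algebra k C] (Θ : C →ₐ[k] Matrix (Fin 2) (Fin 2) C) :
    C →ₗ[k] C where
  toFun x := Θ x 0 1
  map_add' x y := by simp
  map_smul' r x := by simp

theorem corner_mul {C : Type*} [Ring C] [Algebra k C] {G : Set C}
    (hG : Algebra.adjoin k G = ⊤) (Θ : C →ₐ[k] Matrix (Fin 2) (Fin 2) C) (s : C →ₐ[k] C)
    (h : ∀ x ∈ G, Θ x 1 0 = 0 ∧ Θ x 1 1 = x ∧ Θ x 0 0 = s x) (x y : C) :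
    corner Θ (x * y) = corner Θ x * y + s x * corner Θ y := by
  have hx := corner_of_adjoin hG Θ s h x
  have hy := corner_of_adjoin hG Θ s h y
  simp only [corner, LinearMap.coe_mk, AddHom.coe_mk, map_mul, Matrix.mul_apply, Fin.sum_univ_two,
    hx, hy]
  exact add_comm _ _

variable {V : Type*} [AddCommGroup V] [Module k V]

/-- The sign involution of the tensor algebra. -/
def tensorSgn : TensorAlgebra k V →ₐ[k] TensorAlgebra k V :=
  TensorAlgebra.lift k (-TensorAlgebra.ι k)

@[simp] theorem tensorSgn_ι (v : V) :
    tensorSgn (TensorAlgebra.ι k v) = -TensorAlgebra.ι k v := by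
  simp [tensorSgn]

/-- The antiderivation of the tensor algebra that extends a given linear map. -/
def tensorAntider (δ : V →ₗ[k] TensorAlgebra k V) : TensorAlgebra k V →ₗ[k] TensorAlgebra k V :=
  corner (TensorAlgebra.lift k (cornerMatrix (TensorAlgebra.ι k) δ))

@[simp] theorem tensorAntider_ι (δ : V →ₗ[k] TensorAlgebra k V) (v : V) :
    tensorAntider δ (TensorAlgebra.ι k v) = δ v := by
  simp [tensorAntider, corner, cornerMatrix]

theorem tensorAntider_mul (δ : V →ₗ[k] TensorAlgebra k V) (x y : TensorAlgebra k V) :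
    tensorAntider δ (x * y) = tensorAntider δ x * y + tensorSgn x * tensorAntider δ y := by
  refine corner_mul (TensorAlgebra.adjoin_range_ι (R := k) (M := V)) _ _ ?_ x y
  rintro _ ⟨v, rfl⟩
  simp [cornerMatrix]

/-- The sign involution of the exterior algebra. -/
def extSgn : ExteriorAlgebra k V →ₐ[k] ExteriorAlgebra k V :=
  ExteriorAlgebra.lift k ⟨-ExteriorAlgebra.ι k, fun v => by simp⟩

@[simp] theorem extSgn_ι (v : V) :
    extSgn (ExteriorAlgebra.ι k v) = -ExteriorAlgebra.ι k v := by
  simp [extSgn]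

/-- The antiderivation of the exterior algebra that extends a given linear map whose values commute
with the elements of degree one. -/
def extAntider (δ : V →ₗ[k] ExteriorAlgebra k V)
    (hδ : ∀ v w, Commute (δ v) (ExteriorAlgebra.ι k w)) :
    ExteriorAlgebra k V →ₗ[k] ExteriorAlgebra k V :=
  corner (ExteriorAlgebra.lift k ⟨cornerMatrix (ExteriorAlgebra.ι k) δ, fun v => by
    ext i j
    fin_cases i <;> fin_cases j <;>
      simp [cornerMatrix, Matrix.mul_apply, Fin.sum_univ_two, (hδ v v).eq]⟩)

@[simp] theorem extAntider_ι (δ : V →ₗ[k] ExteriorAlgebra k V)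
    (hδ : ∀ v w, Commute (δ v) (ExteriorAlgebra.ι k w)) (v : V) :
    extAntider δ hδ (ExteriorAlgebra.ι k v) = δ v := by
  simp [extAntider, corner, cornerMatrix]

theorem ext_adjoin_range_ι :
    Algebra.adjoin k (Set.range (ExteriorAlgebra.ι k (M := V))) = ⊤ :=
  CliffordAlgebra.adjoin_range_ι

theorem extAntider_mul (δ : V →ₗ[k] ExteriorAlgebra k V)
    (hδ : ∀ v w, Commute (δ v) (ExteriorAlgebra.ι k w)) (x y : ExteriorAlgebra k V) :
    extAntider δ hδ (x * y) = extAntider δ hδ x * y + extSgn x * extAntider δ hδ y := by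
  refine corner_mul ext_adjoin_range_ι _ _ ?_ x y
  rintro _ ⟨v, rfl⟩
  simp [cornerMatrix]

/-- A differential from its values on generators. -/
def Differential.ofGenerators {C : Type*} [Ring C] [Algebra k C] {G : Set C}
    (hG : Algebra.adjoin k G = ⊤) (sgn : C →ₐ[k] C) (d : C →ₗ[k] C)
    (d_mul : ∀ x y, d (x * y) = d x * y + sgn x * d y)
    (hs : ∀ x ∈ G, sgn x = -x) (hsd : ∀ x ∈ G, sgn (d x) = d x) (hdd : ∀ x ∈ G, d (d x) = 0) :
    Differential k C :=
  have ss : ∀ x, sgn (sgn x) = x := fun x => by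
    have : sgn.comp sgn = AlgHom.id k C := by
      apply AlgHom.ext_of_adjoin_eq_top hG
      intro x hx
      simp [hs x hx]
    exact DFunLike.congr_fun this x
  have ds : ∀ x, d (sgn x) = -sgn (d x) := fun x => by
    refine eq_of_adjoin hG (AlgHom.id k C) sgn (d.comp sgn.toLinearMap)
      (-(sgn.toLinearMap.comp d)) ?_ ?_ ?_ x
    · intro x y
      simp [d_mul, ss]
    · intro x y
      simp [d_mul, ss]
      abel
    · intro x hx
      simp [hs x hx, hsd x hx]
  { sgn := sgn
    d := d
    sgn_sgn := ss
    d_sgn := ds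
    d_mul := d_mul
    d_d := fun x => by
      refine eq_of_adjoin hG (AlgHom.id k C) (AlgHom.id k C) (d.comp d) 0 ?_ ?_ ?_ x
      · intro x y
        simp [d_mul, ss, ds]
      · intro x y
        simp
      · intro x hx
        simp [hdd x hx] }

end Antiderivation

/-! ### Bilinear forms as elements of degree two -/

section Forms

open Module

variable {k : Type*} [Field k] {V : Type*} [AddCommGroup V] [Module k V] [FiniteDimensional k V]
variable {C : Type*} [Ring C] [Algebra k C]

/-- The image of a bilinear form under `V* ⊗ V* → C`, `f ⊗ g ↦ j f * j g`, where bilinear forms are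
identified with elements of `V* ⊗ V*` (written out in a basis, on which it does not depend). -/
def formElt (j : Dual k V →ₗ[k] C) : (V →ₗ[k] V →ₗ[k] k) →ₗ[k] C where
  toFun β := ∑ a, ∑ c, β (finBasis k V a) (finBasis k V c) •
    (j ((finBasis k V).coord a) * j ((finBasis k V).coord c))
  map_add' β γ := by simp [add_smul, Finset.sum_add_distrib]
  map_smul' r β := by simp [mul_smul, Finset.smul_sum]

theorem formElt_apply (j : Dual k V →ₗ[k] C) (β : V →ₗ[k] V →ₗ[k] k) :
    formElt j β = ∑ a, ∑ c, β (finBasis k V a) (finBasis k V c) •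
      (j ((finBasis k V).coord a) * j ((finBasis k V).coord c)) := rfl

/-- For a bilinear product `A` on `V`, the linear map that sends a linear form `f` to the element of
degree two given by the bilinear form `f (A x y)`. -/
def quadMap (j : Dual k V →ₗ[k] C) (A : V →ₗ[k] V →ₗ[k] V) : Dual k V →ₗ[k] C where
  toFun f := formElt j (A.compr₂ f)
  map_add' f g := by rw [← map_add]; rfl
  map_smul' r f := by rw [RingHom.id_apply, ← map_smul]; rfl

theorem quadMap_apply (j : Dual k V →ₗ[k] C) (A : V →ₗ[k] V →ₗ[k] V) (f : Dual k V) :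
    quadMap j A f = formElt j (A.compr₂ f) := rfl

theorem dual_expand (f : Dual k V) :
    ∑ a, f (finBasis k V a) • (finBasis k V).coord a = f := by
  refine (finBasis k V).ext fun c => ?_
  simp

theorem apply_expand {M : Type*} [AddCommGroup M] [Module k M] (g : V →ₗ[k] M) (v : V) :
    ∑ a, (finBasis k V).coord a v • g (finBasis k V a) = g v := by
  conv_rhs => rw [← (finBasis k V).sum_repr v, map_sum]
  simp

theorem form_expand (β : V →ₗ[k] V →ₗ[k] k) (v w : V) :
    β v w = ∑ a, ∑ c, β (finBasis k V a) (finBasis k V c) *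
      ((finBasis k V).coord a v * (finBasis k V).coord c w) := by
  have h := apply_expand (β.flip w) v
  simp only [LinearMap.flip_apply] at h
  rw [← h]
  refine Finset.sum_congr rfl fun a _ => ?_
  rw [← apply_expand (β (finBasis k V a)) w, smul_eq_mul, Finset.mul_sum]
  refine Finset.sum_congr rfl fun c _ => ?_
  rw [smul_eq_mul]; ring

theorem formElt_smulRight (j : Dual k V →ₗ[k] C) (f h : Dual k V) :
    formElt j (f.smulRight h) = j f * j h := by
  conv_rhs => rw [← dual_expand f, ← dual_expand h]
  simp only [formElt_apply, map_sum, map_smul, Finset.sum_mul, Finset.mul_sum,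
    smul_mul_smul_comm, LinearMap.smulRight_apply, LinearMap.smul_apply, smul_eq_mul]
  rw [Finset.sum_comm]

/-- The image of a trilinear expression in degree three. -/
def triElt (j : Dual k V →ₗ[k] C) : (V → V → V → k) →ₗ[k] C where
  toFun τ := ∑ a, ∑ c, ∑ e, τ (finBasis k V a) (finBasis k V c) (finBasis k V e) •
    (j ((finBasis k V).coord a) * j ((finBasis k V).coord c) * j ((finBasis k V).coord e))
  map_add' σ τ := by simp [add_smul, Finset.sum_add_distrib]
  map_smul' r τ := by simp [mul_smul, Finset.smul_sum]

theorem triElt_apply (j : Dual k V →ₗ[k] C) (τ : V → V → V → k) : triElt j τ =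
    ∑ a, ∑ c, ∑ e, τ (finBasis k V a) (finBasis k V c) (finBasis k V e) •
      (j ((finBasis k V).coord a) * j ((finBasis k V).coord c) * j ((finBasis k V).coord e)) := rfl

theorem triElt_eq_zero (j : Dual k V →ₗ[k] C) (τ : V → V → V → k) (h : ∀ x y z, τ x y z = 0) :
    triElt j τ = 0 := by
  simp [triElt_apply, h]

theorem formElt_mul (j : Dual k V →ₗ[k] C) (β : V →ₗ[k] V →ₗ[k] k) (f : Dual k V) :
    formElt j β * j f = triElt j (fun x y z => β x y * f z) := by
  conv_lhs => rw [← dual_expand f]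
  simp only [formElt_apply, triElt_apply, map_sum, map_smul, Finset.sum_mul, Finset.mul_sum,
    smul_mul_smul_comm]
  rw [Finset.sum_comm]
  refine Finset.sum_congr rfl fun a _ => ?_
  rw [Finset.sum_comm]

theorem mul_formElt (j : Dual k V →ₗ[k] C) (β : V →ₗ[k] V →ₗ[k] k) (f : Dual k V) :
    j f * formElt j β = triElt j (fun x y z => f x * β y z) := by
  conv_lhs => rw [← dual_expand f]
  simp only [formElt_apply, triElt_apply, map_sum, map_smul, Finset.sum_mul, Finset.mul_sum,
    smul_mul_smul_comm, mul_assoc]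
  conv_rhs => rw [Finset.sum_comm]
  refine Finset.sum_congr rfl fun a _ => ?_
  rw [Finset.sum_comm]

theorem antider_formElt (j : Dual k V →ₗ[k] C) (A : V →ₗ[k] V →ₗ[k] V) (s : C →ₐ[k] C)
    (d : C →ₗ[k] C) (d_mul : ∀ x y, d (x * y) = d x * y + s x * d y)
    (hs : ∀ f, s (j f) = -j f) (hd : ∀ f, d (j f) = quadMap j A f) (β : V →ₗ[k] V →ₗ[k] k) :
    d (formElt j β) = triElt j (fun x y z => β (A x y) z - β x (A y z)) := by
  have e1 : triElt j (fun x y z => β (A x y) z) =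
      ∑ a, ∑ c, β (finBasis k V a) (finBasis k V c) •
        (quadMap j A ((finBasis k V).coord a) * j ((finBasis k V).coord c)) := by
    simp only [quadMap_apply, formElt_mul, ← map_smul, ← map_sum]
    congr 1
    funext x y z
    simp only [Finset.sum_apply, Pi.smul_apply, LinearMap.compr₂_apply, smul_eq_mul]
    exact form_expand β _ _
  have e2 : triElt j (fun x y z => β x (A y z)) =
      ∑ a, ∑ c, β (finBasis k V a) (finBasis k V c) •
        (j ((finBasis k V).coord a) * quadMap j A ((finBasis k V).coord c)) := by
    simp only [quadMap_apply, mul_formElt, ← map_smul, ← map_sum]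
    congr 1
    funext x y z
    simp only [Finset.sum_apply, Pi.smul_apply, LinearMap.compr₂_apply, smul_eq_mul]
    exact form_expand β _ _
  change _ = triElt j ((fun x y z => β (A x y) z) - (fun x y z => β x (A y z)))
  rw [map_sub, e1, e2, formElt_apply]
  simp only [map_sum, map_smul, d_mul, hs, hd, smul_add, Finset.sum_add_distrib, neg_mul, smul_neg,
    Finset.sum_neg_distrib, sub_eq_add_neg]

/-- Degree two elements are compatible with linear maps. -/
theorem formElt_comp {W : Type*} [AddCommGroup W] [Module k W] [FiniteDimensional k W]
    (g : W →ₗ[k] V) (j : Dual k W →ₗ[k] C) (β : V →ₗ[k] V →ₗ[k] k) :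
    formElt (j.comp g.dualMap) β = formElt j (β.compl₁₂ g g) := by
  have e : β.compl₁₂ g g = ∑ a, ∑ c, β (finBasis k V a) (finBasis k V c) •
      (g.dualMap ((finBasis k V).coord a)).smulRight (g.dualMap ((finBasis k V).coord c)) := by
    ext x y
    simp only [LinearMap.compl₁₂_apply, LinearMap.sum_apply, LinearMap.smul_apply,
      LinearMap.smulRight_apply, LinearMap.dualMap_apply, smul_eq_mul]
    exact form_expand β _ _
  rw [e]
  simp only [map_sum, map_smul, formElt_smulRight]
  rfl

end Forms

/-! ### The cohomology ring of an augmented algebra -/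

section Bar

open Module

variable {k : Type*} [Field k]

/-- The augmentation ideal, as a vector space. -/
abbrev AugIdeal {A : Type*} [Ring A] [Algebra k A] (ε : A →ₐ[k] k) : Submodule k A :=
  LinearMap.ker ε.toLinearMap

/-- The restriction of a bilinear product to the augmentation ideal. -/
def augRestrict {A : Type*} [Ring A] [Algebra k A] (ε : A →ₐ[k] k) (P : A →ₗ[k] A →ₗ[k] A)
    (hP : ∀ x y : AugIdeal ε, ε (P x y) = 0) : AugIdeal ε →ₗ[k] AugIdeal ε →ₗ[k] AugIdeal ε :=
  LinearMap.mk₂ k (fun x y => ⟨P x y, hP x y⟩)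
    (fun x y z => Subtype.ext (LinearMap.map_add₂ P (x : A) y z))
    (fun r x y => Subtype.ext (LinearMap.map_smul₂ P r (x : A) y))
    (fun x y z => Subtype.ext (map_add (P x) (y : A) z))
    (fun r x y => Subtype.ext (map_smul (P x) r (y : A)))

@[simp] theorem augRestrict_coe {A : Type*} [Ring A] [Algebra k A] (ε : A →ₐ[k] k)
    (P : A →ₗ[k] A →ₗ[k] A) (hP : ∀ x y : AugIdeal ε, ε (P x y) = 0) (x y : AugIdeal ε) :
    (augRestrict ε P hP x y : A) = P x y := rfl

/-- The negative of the product of the augmentation ideal. -/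
def augNegMul {A : Type*} [Ring A] [Algebra k A] (ε : A →ₐ[k] k) :
    AugIdeal ε →ₗ[k] AugIdeal ε →ₗ[k] AugIdeal ε :=
  augRestrict ε (-LinearMap.mul k A) (fun x y => by
    have hx : ε (x : A) = 0 := x.2
    simp [hx])

@[simp] theorem augNegMul_coe {A : Type*} [Ring A] [Algebra k A] (ε : A →ₐ[k] k)
    (x y : AugIdeal ε) : (augNegMul ε x y : A) = -((x : A) * y) := rfl

/-- The cochains of the normalized bar complex `⨁ Hom (I ⊗ ⋯ ⊗ I, k)` of a finite-dimensional
augmented algebra with augmentation ideal `I` and trivial coefficients, that is, the tensor algebra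
of the dual space of `I`. The cup product of cochains is the product of the tensor algebra. -/
abbrev BarCochains {A : Type*} [Ring A] [Algebra k A] (ε : A →ₐ[k] k) : Type _ :=
  TensorAlgebra k (Dual k (AugIdeal ε))

variable {A : Type*} [Ring A] [Algebra k A] [FiniteDimensional k A] (ε : A →ₐ[k] k)

/-- The differential of the normalized bar complex, the antiderivation with
`(d f) (x, y) = - f (x y)` for `f` of degree one. In general
`(d f) (x₀, …, xₘ) = ∑ᵢ (-1) ^ (i + 1) f (x₀, …, xᵢ xᵢ₊₁, …, xₘ)`. -/
def barDifferential : Differential k (BarCochains ε) :=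
  Differential.ofGenerators (TensorAlgebra.adjoin_range_ι (R := k) (M := Dual k (AugIdeal ε)))
    tensorSgn (tensorAntider (quadMap (TensorAlgebra.ι k) (augNegMul ε)))
    (tensorAntider_mul _)
    (by rintro _ ⟨f, rfl⟩; simp)
    (by
      rintro _ ⟨f, rfl⟩
      simp [quadMap_apply, formElt_apply])
    (by
      rintro _ ⟨f, rfl⟩
      rw [tensorAntider_ι, quadMap_apply,
        antider_formElt (TensorAlgebra.ι k) (augNegMul ε) tensorSgn _ (tensorAntider_mul _)
          tensorSgn_ι (tensorAntider_ι _)]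
      refine triElt_eq_zero _ _ fun x y z => ?_
      have : augNegMul ε (augNegMul ε x y) z = augNegMul ε x (augNegMul ε y z) :=
        Subtype.ext (by simp [mul_assoc])
      simp [this])

/-- The cohomology ring `H^*(A, k)` of a finite-dimensional augmented algebra. -/
abbrev AugCohomology : Type _ := (barDifferential ε).Cohomology

/-- The classes of degree `m`. -/
def AugCohomology.degree (m : ℕ) : Submodule k (AugCohomology ε) :=
  (barDifferential ε).degreePart (LinearMap.range (TensorAlgebra.ι k)) m

end Bar

/-! ### The cohomology ring of a Lie algebra -/

section ChevalleyEilenberg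

open Module

theorem sum_eq_zero_of_cyclic {C : Type*} [AddCommGroup C] {m : ℕ} (T : Fin m → Fin m → Fin m → C)
    (hc : ∀ a b c, T a b c + T b c a + T c a b = 0)
    (h1 : ∀ a b, T a a b = 0) (h2 : ∀ a b, T a b b = 0) (h3 : ∀ a b, T a b a = 0) :
    ∑ a, ∑ b, ∑ c, T a b c = 0 := by
  have key : ∀ a b c, T a b c = (if a < b ∧ a < c then T a b c else 0) +
      (if b < a ∧ b < c then T a b c else 0) + (if c < a ∧ c < b then T a b c else 0) := by
    intro a b c
    rcases eq_or_ne a b with rfl | hab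
    · simp [h1]
    rcases eq_or_ne b c with rfl | hbc
    · simp [h2]
    rcases eq_or_ne a c with rfl | hac
    · simp [h3]
    have e1 := lt_or_gt_of_ne hab
    have e2 := lt_or_gt_of_ne hbc
    have e3 := lt_or_gt_of_ne hac
    split_ifs <;> simp <;> omega
  have e2 : ∑ a, ∑ b, ∑ c, (if b < a ∧ b < c then T a b c else 0) =
      ∑ a, ∑ b, ∑ c, (if a < b ∧ a < c then T c a b else 0) := by
    rw [Finset.sum_comm]
    refine Finset.sum_congr rfl fun a _ => ?_
    rw [Finset.sum_comm]
    refine Finset.sum_congr rfl fun b _ => Finset.sum_congr rfl fun c _ => ?_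
    simp only [and_comm]
  have e3 : ∑ a, ∑ b, ∑ c, (if c < a ∧ c < b then T a b c else 0) =
      ∑ a, ∑ b, ∑ c, (if a < b ∧ a < c then T b c a else 0) := by
    rw [Finset.sum_congr rfl fun a _ => Finset.sum_comm, Finset.sum_comm]
  calc ∑ a, ∑ b, ∑ c, T a b c
      = ∑ a, ∑ b, ∑ c, ((if a < b ∧ a < c then T a b c else 0) +
      (if b < a ∧ b < c then T a b c else 0) + (if c < a ∧ c < b then T a b c else 0)) :=
        Finset.sum_congr rfl fun a _ => Finset.sum_congr rfl fun b _ =>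
          Finset.sum_congr rfl fun c _ => key a b c
    _ = 0 := by
        simp only [Finset.sum_add_distrib]
        rw [e2, e3]
        simp only [← Finset.sum_add_distrib]
        refine Finset.sum_eq_zero fun a _ => Finset.sum_eq_zero fun b _ =>
          Finset.sum_eq_zero fun c _ => ?_
        split_ifs
        · rw [← hc a b c]; abel
        · simp

variable (k : Type*) [Field k] (L : Type*) [LieRing L] [LieAlgebra k L]

/-- Half of the negative bracket. -/
def halfBracket : L →ₗ[k] L →ₗ[k] L :=
  (-(2 : k)⁻¹) • LinearMap.mk₂ k (fun x y => ⁅x, y⁆) add_lie smul_lie lie_add lie_smul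

theorem halfBracket_apply (x y : L) : halfBracket k L x y = (-(2 : k)⁻¹) • ⁅x, y⁆ := rfl

/-- The cochains of the Chevalley-Eilenberg complex of a finite-dimensional Lie algebra with trivial
coefficients, the exterior algebra of the dual space. -/
abbrev CECochains : Type _ := ExteriorAlgebra k (Dual k L)

variable [FiniteDimensional k L]

theorem ext_formElt_commute (β : L →ₗ[k] L →ₗ[k] k) (f : Dual k L) :
    Commute (formElt (ExteriorAlgebra.ι k) β : CECochains k L) (ExteriorAlgebra.ι k f) := by
  have h : ∀ x y : Dual k L, ExteriorAlgebra.ι k x * ExteriorAlgebra.ι k y =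
      -(ExteriorAlgebra.ι k y * ExteriorAlgebra.ι k x) := fun x y =>
    eq_neg_of_add_eq_zero_left (ExteriorAlgebra.ι_add_mul_swap x y)
  rw [formElt_apply]
  refine Commute.sum_left _ _ _ fun a _ => Commute.sum_left _ _ _ fun c _ => ?_
  refine Commute.smul_left ?_ _
  rw [commute_iff_eq, mul_assoc, h _ f, mul_neg, ← mul_assoc, h _ f, neg_mul, neg_neg, mul_assoc]

theorem ext_quadMap_commute (f g : Dual k L) :
    Commute (quadMap (ExteriorAlgebra.ι k) (halfBracket k L) f : CECochains k L)
      (ExteriorAlgebra.ι k g) :=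
  ext_formElt_commute k L _ _

/-- The Chevalley-Eilenberg differential (in characteristic different from two), the antiderivation
with `(d f) (x, y) = - f [x, y]` for `f` of degree one: in a basis with structure constants
`f [b_a, b_c]` it sends `f` to `- ∑_{a < c} f [b_a, b_c] b_a^* ∧ b_c^*`, which is half of the sum over
all pairs `a, c`. -/
def ceDifferential : Differential k (CECochains k L) :=
  Differential.ofGenerators ext_adjoin_range_ι extSgn
    (extAntider (quadMap (ExteriorAlgebra.ι k) (halfBracket k L))
      (ext_quadMap_commute k L))
    (extAntider_mul _ _)
    (by rintro _ ⟨f, rfl⟩; simp)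
    (by
      rintro _ ⟨f, rfl⟩
      simp [quadMap_apply, formElt_apply])
    (by
      rintro _ ⟨f, rfl⟩
      rw [extAntider_ι, quadMap_apply,
        antider_formElt (ExteriorAlgebra.ι k) (halfBracket k L) extSgn _ (extAntider_mul _ _)
          extSgn_ι (extAntider_ι _ _), triElt_apply]
      have hsw : ∀ x y : Dual k L, ExteriorAlgebra.ι k x * ExteriorAlgebra.ι k y =
          -(ExteriorAlgebra.ι k y * ExteriorAlgebra.ι k x) := fun x y =>
        eq_neg_of_add_eq_zero_left (ExteriorAlgebra.ι_add_mul_swap x y)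
      have hcy : ∀ x y z : Dual k L,
          ExteriorAlgebra.ι k y * ExteriorAlgebra.ι k z * ExteriorAlgebra.ι k x =
          ExteriorAlgebra.ι k x * ExteriorAlgebra.ι k y * ExteriorAlgebra.ι k z := by
        intro x y z
        rw [mul_assoc, hsw z x, mul_neg, ← mul_assoc, hsw y x, neg_mul, neg_neg]
      refine sum_eq_zero_of_cyclic _ ?_ ?_ ?_ ?_
      · intro a b c
        rw [hcy _ _ ((finBasis k L).coord c), ← hcy ((finBasis k L).coord c), ← add_smul, ← add_smul]
        convert zero_smul k _
        simp only [LinearMap.compr₂_apply, halfBracket_apply, map_smul, LinearMap.smul_apply]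
        simp only [← map_smul, ← map_sub, ← map_add]
        convert map_zero f
        have hj := lie_jacobi (finBasis k L a) (finBasis k L b) (finBasis k L c)
        have e : ∀ u v w : L, ⁅⁅u, v⁆, w⁆ = -⁅w, ⁅u, v⁆⁆ := fun u v w => (lie_skew _ _).symm
        simp only [e]
        linear_combination (norm := module) (-(2 : k) * ((2 : k)⁻¹ * (2 : k)⁻¹)) • hj
      · intro a b
        simp
      · intro a b
        simp [mul_assoc]
      · intro a b
        rw [mul_assoc, hsw ((finBasis k L).coord b)]
        simp [← mul_assoc])

/-- The ordinary Lie algebra cohomology ring `H^*(L, k)`. -/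
abbrev LieCohomology : Type _ := (ceDifferential k L).Cohomology

/-- The classes of degree `m`. -/
def LieCohomology.degree (m : ℕ) : Submodule k (LieCohomology k L) :=
  (ceDifferential k L).degreePart (LinearMap.range (ExteriorAlgebra.ι k)) m

end ChevalleyEilenberg

/-! ### Restricted Lie algebras and their restricted enveloping algebras -/

section Restricted

attribute [local instance 100] LieRing.ofAssociativeRing

/-- The Jacobson polynomials `s_i (x, y)`: `i • s_i (x, y)` is the coefficient of `t ^ (i - 1)` in
`ad (t x + y) ^ (p - 1) (x)`. -/
def jacobsonPoly (p : ℕ) (k : Type*) [Field k] {L : Type*} [LieRing L] [LieAlgebra k L] (i : ℕ)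
    (x y : L) : L :=
  (i : k)⁻¹ • ((((Polynomial.X * Polynomial.C (LieAlgebra.ad k L x : Module.End k L) +
    Polynomial.C (LieAlgebra.ad k L y : Module.End k L)) ^ (p - 1)).coeff (i - 1) :
      Module.End k L) x)

/-- A restricted Lie algebra over a field of characteristic `p`: a Lie algebra with a `p`-power
operation `x ↦ x^[p]` that satisfies Jacobson's axioms. -/
class RestrictedLieAlgebra (p : ℕ) (k : Type*) [Field k] (L : Type*) [LieRing L]
    [LieAlgebra k L] where
  pPow : L → L
  pPow_smul : ∀ (r : k) (x : L), pPow (r • x) = r ^ p • pPow x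
  ad_pPow : ∀ x : L, (LieAlgebra.ad k L (pPow x) : Module.End k L) =
    (LieAlgebra.ad k L x : Module.End k L) ^ p
  pPow_add : ∀ x y : L, pPow (x + y) =
    pPow x + pPow y + ∑ i ∈ Finset.Ico 1 p, jacobsonPoly p k i x y

variable (p : ℕ) [Fact p.Prime] (k : Type*) [Field k] [CharP k p]
variable (L : Type*) [LieRing L] [LieAlgebra k L] [RestrictedLieAlgebra p k L]

/-- The `p`-power operation of a restricted Lie algebra. -/
abbrev pPow (x : L) : L := RestrictedLieAlgebra.pPow p k x

/-- The element `x ^ p - x^[p]` of the universal enveloping algebra. -/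
def pRel (x : L) : UniversalEnvelopingAlgebra k L :=
  UniversalEnvelopingAlgebra.ι k x ^ p - UniversalEnvelopingAlgebra.ι k (pPow p k L x)

theorem adjoin_range_uι :
    Algebra.adjoin k (Set.range (UniversalEnvelopingAlgebra.ι k (L := L))) = ⊤ := by
  have h : Function.Surjective (UniversalEnvelopingAlgebra.mkAlgHom k L) :=
    RingCon.mk'_surjective (UniversalEnvelopingAlgebra.ringCon k L)
  rw [← top_le_iff, ← (AlgHom.range_eq_top _).2 h, ← Algebra.map_top,
    ← TensorAlgebra.adjoin_range_ι, AlgHom.map_adjoin]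
  refine Algebra.adjoin_mono ?_
  rintro _ ⟨_, ⟨x, rfl⟩, rfl⟩
  exact ⟨x, rfl⟩

/-- The augmentation of the universal enveloping algebra. -/
def uAug : UniversalEnvelopingAlgebra k L →ₐ[k] k := UniversalEnvelopingAlgebra.lift k 0

theorem uAug_ι (x : L) : uAug k L (UniversalEnvelopingAlgebra.ι k x) = 0 := by
  rw [uAug, UniversalEnvelopingAlgebra.lift_ι_apply]; rfl

instance : Nontrivial (UniversalEnvelopingAlgebra k L) := (uAug k L).toRingHom.domain_nontrivial

theorem commutator_pow (x y : L) (m : ℕ) :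
    ((LinearMap.mulLeft k (UniversalEnvelopingAlgebra.ι k x) -
      LinearMap.mulRight k (UniversalEnvelopingAlgebra.ι k x)) ^ m :
        Module.End k (UniversalEnvelopingAlgebra k L)) (UniversalEnvelopingAlgebra.ι k y) =
    UniversalEnvelopingAlgebra.ι k (((LieAlgebra.ad k L x : Module.End k L) ^ m) y) := by
  induction m with
  | zero => simp
  | succ m ih =>
    rw [pow_succ', pow_succ', Module.End.mul_apply, Module.End.mul_apply, ih, LieAlgebra.ad_apply,
      LieHom.map_lie]
    rfl

theorem pRel_commute_ι (x y : L) :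
    Commute (pRel p k L x) (UniversalEnvelopingAlgebra.ι k y) := by
  have : CharP (Module.End k (UniversalEnvelopingAlgebra k L)) p :=
    charP_of_injective_algebraMap
      (algebraMap k (Module.End k (UniversalEnvelopingAlgebra k L))).injective p
  have h := commutator_pow k L x y p
  rw [sub_pow_char_of_commute p (LinearMap.commute_mulLeft_right _ _),
    ← RestrictedLieAlgebra.ad_pPow, LieAlgebra.ad_apply, LieHom.map_lie, LinearMap.pow_mulLeft,
    LinearMap.pow_mulRight, LinearMap.sub_apply, LinearMap.mulLeft_apply, LinearMap.mulRight_apply,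
    LieRing.of_associative_ring_bracket] at h
  rw [commute_iff_eq, pRel, sub_mul, mul_sub, sub_eq_sub_iff_sub_eq_sub]
  exact h

theorem pRel_commute (x : L) (u : UniversalEnvelopingAlgebra k L) : Commute (pRel p k L x) u := by
  have hu : u ∈ Algebra.adjoin k (Set.range (UniversalEnvelopingAlgebra.ι k (L := L))) := by
    rw [adjoin_range_uι]; trivial
  induction hu using Algebra.adjoin_induction with
  | mem u hu =>
    obtain ⟨y, rfl⟩ := hu
    exact pRel_commute_ι p k L x y
  | algebraMap r => exact (Algebra.commutes r _).symm
  | add u v _ _ hu hv => exact hu.add_right hv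
  | mul u v _ _ hu hv => exact hu.mul_right hv

/-- The ideal of the universal enveloping algebra generated by the elements `x ^ p - x^[p]`. These
are central, so that the left ideal that they generate is two-sided. -/
def restrictedIdeal : Ideal (UniversalEnvelopingAlgebra k L) :=
  Ideal.span (Set.range (pRel p k L))

theorem restrictedIdeal_induction {M : UniversalEnvelopingAlgebra k L → Prop} (h0 : M 0)
    (hadd : ∀ u v, M u → M v → M (u + v)) (hmul : ∀ u x, M (u * pRel p k L x))
    {u : UniversalEnvelopingAlgebra k L} (hu : u ∈ restrictedIdeal p k L) : M u := by
  obtain ⟨m, f, g, rfl⟩ := (Submodule.mem_span_set' (R := UniversalEnvelopingAlgebra k L)).1 hu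
  refine Finset.sum_induction _ M hadd h0 fun i _ => ?_
  obtain ⟨x, hx⟩ := (g i).2
  rw [← hx]
  exact hmul _ _

instance : (restrictedIdeal p k L).IsTwoSided where
  mul_mem_of_left := by
    intro u v hu
    refine restrictedIdeal_induction p k L (M := fun u => u * v ∈ restrictedIdeal p k L) ?_ ?_ ?_ hu
    · simp
    · intro u w hu hw
      rw [add_mul]
      exact add_mem hu hw
    · intro u x
      rw [mul_assoc, (pRel_commute p k L x v).eq, ← mul_assoc]
      exact Ideal.mul_mem_left _ _ (Ideal.subset_span ⟨x, rfl⟩)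

/-- The restricted enveloping algebra `u(L) = U(L) / (x ^ p - x^[p])`. -/
abbrev RestrictedEnveloping : Type _ := UniversalEnvelopingAlgebra k L ⧸ restrictedIdeal p k L

/-- The projection `U(L) → u(L)`. -/
def proj : UniversalEnvelopingAlgebra k L →ₐ[k] RestrictedEnveloping p k L :=
  Ideal.Quotient.mkₐ k (restrictedIdeal p k L)

theorem proj_surjective : Function.Surjective (proj p k L) := Ideal.Quotient.mkₐ_surjective k _

theorem proj_eq_zero {u : UniversalEnvelopingAlgebra k L} :
    proj p k L u = 0 ↔ u ∈ restrictedIdeal p k L := Ideal.Quotient.eq_zero_iff_mem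

theorem proj_pRel (x : L) : proj p k L (pRel p k L x) = 0 :=
  (proj_eq_zero p k L).2 (Ideal.subset_span ⟨x, rfl⟩)

theorem uAug_pRel (x : L) : uAug k L (pRel p k L x) = 0 := by
  have : p ≠ 0 := (Fact.out : p.Prime).ne_zero
  rw [pRel, map_sub, map_pow, uAug_ι, uAug_ι, zero_pow this, sub_zero]

/-- The augmentation of the restricted enveloping algebra. -/
def resAug : RestrictedEnveloping p k L →ₐ[k] k :=
  Ideal.Quotient.liftₐ _ (uAug k L) (fun u hu => by
    refine restrictedIdeal_induction p k L (M := fun u => uAug k L u = 0) ?_ ?_ ?_ hu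
    · simp
    · intro u v hu hv
      rw [map_add, hu, hv, add_zero]
    · intro u x
      rw [map_mul, uAug_pRel, mul_zero])

@[simp] theorem resAug_proj (u : UniversalEnvelopingAlgebra k L) :
    resAug p k L (proj p k L u) = uAug k L u := rfl

/-- The linear map from `L` to the augmentation ideal of `u(L)`. -/
def toAug : L →ₗ[k] AugIdeal (resAug p k L) :=
  ((proj p k L).toLinearMap.comp
    ((UniversalEnvelopingAlgebra.ι k : L →ₗ⁅k⁆ UniversalEnvelopingAlgebra k L) :
      L →ₗ[k] UniversalEnvelopingAlgebra k L)).codRestrict _ (fun x => uAug_ι k L x)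

theorem toAug_coe (x : L) :
    (toAug p k L x : RestrictedEnveloping p k L) = proj p k L (UniversalEnvelopingAlgebra.ι k x) :=
  rfl

theorem toAug_lie (x y : L) : (toAug p k L ⁅x, y⁆ : RestrictedEnveloping p k L) =
    (toAug p k L x : RestrictedEnveloping p k L) * toAug p k L y -
      (toAug p k L y : RestrictedEnveloping p k L) * toAug p k L x := by
  simp only [toAug_coe, LieHom.map_lie, ← map_mul, ← map_sub]
  rfl

theorem toAug_pow (x : L) : (toAug p k L x : RestrictedEnveloping p k L) ^ p =
    toAug p k L (pPow p k L x) := by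
  have := proj_pRel p k L x
  rw [pRel, map_sub, map_pow, sub_eq_zero] at this
  exact this

end Restricted

/-! ### The restricted enveloping algebra is finite-dimensional -/

section Finite

attribute [local instance 100] LieRing.ofAssociativeRing

open Module

variable (p : ℕ) [Fact p.Prime] (k : Type*) [Field k] [CharP k p]
variable (L : Type*) [LieRing L] [LieAlgebra k L] [RestrictedLieAlgebra p k L]
variable [FiniteDimensional k L]

/-- The basis elements of `L`, in `u(L)`. -/
def gen (a : Fin (finrank k L)) : RestrictedEnveloping p k L := toAug p k L (finBasis k L a)

/-- The span of the products of fewer than `m` basis elements. -/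
def shortProd (m : ℕ) : Submodule k (RestrictedEnveloping p k L) :=
  Submodule.span k {u | ∃ l : List (Fin (finrank k L)), l.length < m ∧ (l.map (gen p k L)).prod = u}

theorem prod_mem_shortProd {m : ℕ} (l : List (Fin (finrank k L))) (hl : l.length < m) :
    (l.map (gen p k L)).prod ∈ shortProd p k L m := Submodule.subset_span ⟨l, hl, rfl⟩

theorem prod_mul_mem_shortProd {m m' : ℕ} (l : List (Fin (finrank k L))) (hm : l.length + m ≤ m')
    {u : RestrictedEnveloping p k L} (hu : u ∈ shortProd p k L m) :
    (l.map (gen p k L)).prod * u ∈ shortProd p k L m' := by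
  have : shortProd p k L m ≤
      (shortProd p k L m').comap (LinearMap.mulLeft k ((l.map (gen p k L)).prod)) := by
    refine Submodule.span_le.2 ?_
    rintro _ ⟨l', hl', rfl⟩
    change (l.map (gen p k L)).prod * (l'.map (gen p k L)).prod ∈ shortProd p k L m'
    rw [← List.prod_append, ← List.map_append]
    exact prod_mem_shortProd p k L _ (by rw [List.length_append]; omega)
  exact this hu

theorem toAug_mul_prod_mem (x : L) (l : List (Fin (finrank k L))) {m : ℕ} (hl : l.length + 1 < m) :
    (toAug p k L x : RestrictedEnveloping p k L) * (l.map (gen p k L)).prod ∈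
      shortProd p k L m := by
  rw [← (finBasis k L).sum_repr x, map_sum, Submodule.coe_sum, Finset.sum_mul]
  refine Submodule.sum_mem _ fun a _ => ?_
  rw [map_smul, Submodule.coe_smul, smul_mul_assoc]
  refine Submodule.smul_mem _ _ ?_
  exact prod_mem_shortProd p k L (a :: l) (by simpa using hl)

theorem prod_perm {l l' : List (Fin (finrank k L))} (h : l.Perm l') :
    (l.map (gen p k L)).prod - (l'.map (gen p k L)).prod ∈ shortProd p k L l.length := by
  induction h with
  | nil => simp
  | cons a h ih =>
    simp only [List.map_cons, List.prod_cons, ← mul_sub, List.length_cons]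
    simpa using prod_mul_mem_shortProd p k L [a] (m' := _ + 1) (by simp [add_comm]) ih
  | swap a b l =>
    simp only [List.map_cons, List.prod_cons, ← mul_assoc, ← sub_mul, List.length_cons]
    rw [gen, gen, ← toAug_lie]
    exact toAug_mul_prod_mem p k L _ l (by omega)
  | trans h h' ih ih' =>
    rw [← h.length_eq] at ih'
    simpa using add_mem ih ih'

theorem prod_mem_bound (l : List (Fin (finrank k L))) :
    (l.map (gen p k L)).prod ∈ shortProd p k L (finrank k L * (p - 1) + 1) := by
  induction hm : l.length using Nat.strong_induction_on generalizing l with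
  | _ m ih =>
  by_cases hl : l.length < finrank k L * (p - 1) + 1
  · exact prod_mem_shortProd p k L l hl
  have hp : 2 ≤ p := (Fact.out : p.Prime).two_le
  have hshort : ∀ u ∈ shortProd p k L l.length,
      u ∈ shortProd p k L (finrank k L * (p - 1) + 1) := by
    intro u hu
    have : shortProd p k L l.length ≤ shortProd p k L (finrank k L * (p - 1) + 1) := by
      refine Submodule.span_le.2 ?_
      rintro _ ⟨l', hl', rfl⟩
      exact ih _ (hm ▸ hl') l' rfl
    exact this hu
  obtain ⟨a, ha⟩ : ∃ a, p ≤ l.count a := by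
    by_contra! hcon
    have h1 : l.length = ∑ a, l.count a := by
      simpa using (Multiset.sum_count_eq_card (s := Finset.univ) (m := (l : Multiset (Fin (finrank k L))))
        (fun _ _ => Finset.mem_univ _)).symm
    have h2 : ∑ a, l.count a ≤ ∑ _a : Fin (finrank k L), (p - 1) :=
      Finset.sum_le_sum fun a _ => by have := hcon a; omega
    rw [Finset.sum_const, Finset.card_univ, Fintype.card_fin, smul_eq_mul] at h2
    omega
  obtain ⟨l', hl'⟩ := (List.replicate_sublist_iff.2 ha).exists_perm_append
  have h1 := hshort _ (prod_perm p k L hl')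
  have hlen := hl'.length_eq
  rw [List.length_append, List.length_replicate] at hlen
  have h2 : ((List.replicate p a ++ l').map (gen p k L)).prod ∈ shortProd p k L l.length := by
    rw [List.map_append, List.prod_append, List.map_replicate, List.prod_replicate, gen, toAug_pow]
    exact toAug_mul_prod_mem p k L _ l' (by omega)
  have := add_mem h1 (hshort _ h2)
  simpa using this

theorem shortProd_eq_top : shortProd p k L (finrank k L * (p - 1) + 1) = ⊤ := by
  rw [eq_top_iff]
  have hgen : Algebra.adjoin k (Set.range (gen p k L)) = ⊤ := by
    rw [eq_top_iff, ← (AlgHom.range_eq_top _).2 (proj_surjective p k L), ← Algebra.map_top,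
      ← adjoin_range_uι, AlgHom.map_adjoin]
    refine Algebra.adjoin_le ?_
    rintro _ ⟨_, ⟨x, rfl⟩, rfl⟩
    rw [← toAug_coe, ← (finBasis k L).sum_repr x, map_sum, Submodule.coe_sum]
    refine Subalgebra.sum_mem _ fun a _ => ?_
    rw [map_smul, Submodule.coe_smul]
    exact Subalgebra.smul_mem _ (Algebra.subset_adjoin (Set.mem_range_self a)) _
  rw [← Algebra.top_toSubmodule, ← hgen, Algebra.adjoin_eq_span]
  refine Submodule.span_le.2 ?_
  intro u hu
  obtain ⟨l, hl, rfl⟩ := Submonoid.exists_list_of_mem_closure hu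
  obtain ⟨l', rfl⟩ : ∃ l', l = List.map (gen p k L) l' := by
    have := Set.range_list_map (gen p k L)
    have h2 : l ∈ Set.range (List.map (gen p k L)) := by rw [this]; exact hl
    obtain ⟨l', h⟩ := h2
    exact ⟨l', h.symm⟩
  exact prod_mem_bound p k L l'

instance : FiniteDimensional k (RestrictedEnveloping p k L) := by
  refine Module.finite_def.2 ?_
  rw [← shortProd_eq_top]
  refine Submodule.fg_span ?_
  refine ((List.finite_length_lt (Fin (finrank k L)) (finrank k L * (p - 1) + 1)).image
    (fun l => (l.map (gen p k L)).prod)).subset ?_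
  rintro _ ⟨l, hl, rfl⟩
  exact ⟨l, hl, rfl⟩

end Finite

/-! ### The homomorphism from the symmetric algebra -/

section Transgression

attribute [local instance 100] LieRing.ofAssociativeRing

open Module

variable (p : ℕ) [Fact p.Prime] (k : Type*) [Field k] [CharP k p]
variable (L : Type*) [LieRing L] [LieAlgebra k L] [RestrictedLieAlgebra p k L]

/-- The space `(L^*)^(1)`: the Frobenius-semilinear functions `L → k`, that is, the linear functions
on the Frobenius twist of `L`. -/
abbrev TwistedDual : Type _ := L →ₛₗ[frobenius k p] k

/-- The pairs of a linear form `Λ` on `U(L)` and a twisted linear form `f` on `L` such that `Λ`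
vanishes on `U⁺ I`, where `U⁺` is the augmentation ideal and `I` the kernel of `U(L) → u(L)`, and
`Λ (x ^ p - x^[p]) = f x`. Thus `f` describes the restriction of `Λ` to `I`. -/
def transgressive : Submodule k (Dual k (UniversalEnvelopingAlgebra k L) × TwistedDual p k L) where
  carrier := {t | (∀ u x, uAug k L u = 0 → t.1 (u * pRel p k L x) = 0) ∧
    ∀ x, t.1 (pRel p k L x) = t.2 x}
  zero_mem' := ⟨fun _ _ _ => rfl, fun _ => rfl⟩
  add_mem' := by
    rintro s t ⟨hs, hs'⟩ ⟨ht, ht'⟩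
    refine ⟨fun u x hu => ?_, fun x => ?_⟩
    · change s.1 _ + t.1 _ = 0
      rw [hs u x hu, ht u x hu, add_zero]
    · change s.1 _ + t.1 _ = s.2 x + t.2 x
      rw [hs', ht']
  smul_mem' := by
    rintro r t ⟨ht, ht'⟩
    refine ⟨fun u x hu => ?_, fun x => ?_⟩
    · change r • t.1 _ = 0
      rw [ht u x hu, smul_zero]
    · change r • t.1 _ = r • t.2 x
      rw [ht']

variable {p k L}

theorem transgressive_apply (t : transgressive p k L) (u : UniversalEnvelopingAlgebra k L) (x : L) :
    t.1.1 (u * pRel p k L x) = uAug k L u * t.1.2 x := by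
  have h := t.2.1 (u - algebraMap k _ (uAug k L u)) x (by simp)
  rw [sub_mul, map_sub, sub_eq_zero, ← Algebra.smul_def, map_smul, t.2.2 x] at h
  exact h

theorem transgressive_left (t : transgressive p k L) {u v : UniversalEnvelopingAlgebra k L}
    (hu : u ∈ restrictedIdeal p k L) (hv : uAug k L v = 0) : t.1.1 (u * v) = 0 := by
  refine restrictedIdeal_induction p k L (M := fun u => t.1.1 (u * v) = 0) ?_ ?_ ?_ hu
  · simp
  · intro u w hu hw
    rw [add_mul, map_add, hu, hw, add_zero]
  · intro u x
    rw [mul_assoc, (pRel_commute p k L x v).eq, ← mul_assoc, transgressive_apply, map_mul, hv]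
    simp

theorem transgressive_right (t : transgressive p k L) {u v : UniversalEnvelopingAlgebra k L}
    (hu : uAug k L u = 0) (hv : v ∈ restrictedIdeal p k L) : t.1.1 (u * v) = 0 := by
  refine restrictedIdeal_induction p k L (M := fun v => t.1.1 (u * v) = 0) ?_ ?_ ?_ hv
  · simp
  · intro u w hu hw
    rw [mul_add, map_add, hu, hw, add_zero]
  · intro v x
    rw [← mul_assoc, transgressive_apply, map_mul, hu]
    simp

variable (p k L)

/-- A linear section of `U(L) → u(L)`. -/
def sect : RestrictedEnveloping p k L →ₗ[k] UniversalEnvelopingAlgebra k L :=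
  Classical.choose ((proj p k L).toLinearMap.exists_rightInverse_of_surjective
    (LinearMap.range_eq_top.2 (proj_surjective p k L)))

@[simp] theorem proj_sect (a : RestrictedEnveloping p k L) : proj p k L (sect p k L a) = a :=
  LinearMap.congr_fun (Classical.choose_spec
    ((proj p k L).toLinearMap.exists_rightInverse_of_surjective
      (LinearMap.range_eq_top.2 (proj_surjective p k L)))) a

theorem uAug_sect (a : RestrictedEnveloping p k L) :
    uAug k L (sect p k L a) = resAug p k L a := by
  rw [← resAug_proj p, proj_sect]

theorem sect_proj_sub (u : UniversalEnvelopingAlgebra k L) :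
    sect p k L (proj p k L u) - u ∈ restrictedIdeal p k L := by
  rw [← proj_eq_zero, map_sub, proj_sect, sub_self]

/-- The two-cocycle on the augmentation ideal of `u(L)` with `(proj u, proj v) ↦ - Λ (u v)` for `u`,
`v` in the augmentation ideal of `U(L)`. On `U(L)` it is the coboundary of `Λ`. -/
def transForm : transgressive p k L →ₗ[k]
    (AugIdeal (resAug p k L) →ₗ[k] AugIdeal (resAug p k L) →ₗ[k] k) where
  toFun t := LinearMap.mk₂ k
    (fun x y => -t.1.1 (sect p k L (x : RestrictedEnveloping p k L) *
      sect p k L (y : RestrictedEnveloping p k L)))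
    (fun x y z => by rw [Submodule.coe_add, map_add, add_mul, map_add, neg_add])
    (fun r x y => by rw [Submodule.coe_smul, map_smul, smul_mul_assoc, map_smul, smul_neg])
    (fun x y z => by rw [Submodule.coe_add, map_add, mul_add, map_add, neg_add])
    (fun r x y => by rw [Submodule.coe_smul, map_smul, mul_smul_comm, map_smul, smul_neg])
  map_add' s t := LinearMap.ext₂ fun x y => neg_add (s.1.1 _) (t.1.1 _)
  map_smul' r t := LinearMap.ext₂ fun x y => (smul_neg r (t.1.1 _)).symm

theorem transForm_apply (t : transgressive p k L) (x y : AugIdeal (resAug p k L)) :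
    transForm p k L t x y = -t.1.1 (sect p k L x * sect p k L y) := rfl

theorem transForm_proj (t : transgressive p k L) (x y : AugIdeal (resAug p k L))
    (u v : UniversalEnvelopingAlgebra k L) (hu : proj p k L u = x) (hv : proj p k L v = y) :
    transForm p k L t x y = -t.1.1 (u * v) := by
  have hx : resAug p k L x = 0 := x.2
  have hy : resAug p k L y = 0 := y.2
  have hu0 : uAug k L u = 0 := by rw [← resAug_proj p, hu, hx]
  have h1 := transgressive_left t (sect_proj_sub p k L u) (v := sect p k L y)
    (by rw [uAug_sect, hy])
  have h2 := transgressive_right t hu0 (sect_proj_sub p k L v)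
  rw [hu, sub_mul, map_sub, sub_eq_zero] at h1
  rw [hv, mul_sub, map_sub, sub_eq_zero] at h2
  rw [transForm_apply, h1, h2]

/-! Commutation with the classes of transgressive forms. -/

/-- The comultiplication of the universal enveloping algebra. -/
def comul : UniversalEnvelopingAlgebra k L →ₐ[k]
    UniversalEnvelopingAlgebra k L ⊗[k] UniversalEnvelopingAlgebra k L :=
  UniversalEnvelopingAlgebra.lift k
    { toFun := fun x => UniversalEnvelopingAlgebra.ι k x ⊗ₜ 1 + 1 ⊗ₜ UniversalEnvelopingAlgebra.ι k x
      map_add' := fun x y => by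
        rw [map_add, TensorProduct.add_tmul, TensorProduct.tmul_add]; abel
      map_smul' := fun r x => by
        simp only [map_smul, TensorProduct.smul_tmul', TensorProduct.tmul_smul, smul_add,
          RingHom.id_apply]
      map_lie' := fun {x y} => by
        rw [LieHom.map_lie, LieRing.of_associative_ring_bracket,
          LieRing.of_associative_ring_bracket]
        simp only [mul_add, add_mul, Algebra.TensorProduct.tmul_mul_tmul, mul_one, one_mul,
          TensorProduct.sub_tmul, TensorProduct.tmul_sub]
        abel }

theorem comul_ι (x : L) : comul k L (UniversalEnvelopingAlgebra.ι k x) =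
    UniversalEnvelopingAlgebra.ι k x ⊗ₜ 1 + 1 ⊗ₜ UniversalEnvelopingAlgebra.ι k x := by
  rw [comul, UniversalEnvelopingAlgebra.lift_ι_apply]; rfl

theorem comul_pRel (x : L) : comul k L (pRel p k L x) =
    pRel p k L x ⊗ₜ 1 + 1 ⊗ₜ pRel p k L x := by
  have : CharP (UniversalEnvelopingAlgebra k L ⊗[k] UniversalEnvelopingAlgebra k L) p :=
    charP_of_injective_algebraMap (algebraMap k _).injective p
  have hc : Commute (UniversalEnvelopingAlgebra.ι k x ⊗ₜ[k] (1 : UniversalEnvelopingAlgebra k L))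
      ((1 : UniversalEnvelopingAlgebra k L) ⊗ₜ[k] UniversalEnvelopingAlgebra.ι k x) := by
    simp [commute_iff_eq, Algebra.TensorProduct.tmul_mul_tmul]
  rw [pRel, map_sub, map_pow, comul_ι, comul_ι, add_pow_char_of_commute p hc,
    Algebra.TensorProduct.tmul_pow, Algebra.TensorProduct.tmul_pow, one_pow,
    TensorProduct.sub_tmul, TensorProduct.tmul_sub]
  abel

/-- The map `u ⊗ v ↦ Λ v • proj u`. -/
def evalRight (Λ : Dual k (UniversalEnvelopingAlgebra k L)) :
    UniversalEnvelopingAlgebra k L ⊗[k] UniversalEnvelopingAlgebra k L →ₗ[k]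
      RestrictedEnveloping p k L :=
  TensorProduct.lift ((LinearMap.lsmul k (RestrictedEnveloping p k L)).flip.compl₁₂
    (proj p k L).toLinearMap Λ)

@[simp] theorem evalRight_tmul (Λ : Dual k (UniversalEnvelopingAlgebra k L))
    (u v : UniversalEnvelopingAlgebra k L) :
    evalRight p k L Λ (u ⊗ₜ v) = Λ v • proj p k L u := rfl

/-- The extension of a linear form on `U(L)` to a linear map `U(L) → u(L)`. -/
def extend (Λ : Dual k (UniversalEnvelopingAlgebra k L)) :
    UniversalEnvelopingAlgebra k L →ₗ[k] RestrictedEnveloping p k L :=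
  (evalRight p k L Λ).comp (comul k L).toLinearMap

theorem resAug_extend (Λ : Dual k (UniversalEnvelopingAlgebra k L))
    (u : UniversalEnvelopingAlgebra k L) : resAug p k L (extend p k L Λ u) = Λ u := by
  have h1 : ∀ w, resAug p k L (evalRight p k L Λ w) =
      Λ (TensorProduct.lid k _ (Algebra.TensorProduct.map (uAug k L) (AlgHom.id k _) w)) := by
    intro w
    induction w with
    | zero => simp
    | tmul a b => simp [mul_comm]
    | add a b ha hb => simp only [map_add, ha, hb]
  have h2 : ((Algebra.TensorProduct.lid k _).toAlgHom.comp
      (Algebra.TensorProduct.map (uAug k L) (AlgHom.id k _))).comp (comul k L) = AlgHom.id k _ := by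
    refine UniversalEnvelopingAlgebra.hom_ext k (LieHom.ext fun x => ?_)
    change TensorProduct.lid k _ (Algebra.TensorProduct.map (uAug k L) (AlgHom.id k _)
      (comul k L (UniversalEnvelopingAlgebra.ι k x))) = UniversalEnvelopingAlgebra.ι k x
    rw [comul_ι, map_add, Algebra.TensorProduct.map_tmul, Algebra.TensorProduct.map_tmul, uAug_ι,
      TensorProduct.zero_tmul, zero_add, TensorProduct.lid_tmul, map_one (uAug k L), one_smul]
    rfl
  rw [extend, LinearMap.comp_apply, h1]
  exact congrArg Λ (AlgHom.congr_fun h2 u)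

theorem evalRight_uAug (u : UniversalEnvelopingAlgebra k L) :
    evalRight p k L (uAug k L).toLinearMap (comul k L u) = proj p k L u := by
  have h1 : ∀ w, evalRight p k L (uAug k L).toLinearMap w =
      TensorProduct.rid k _ (Algebra.TensorProduct.map (proj p k L) (uAug k L) w) := by
    intro w
    induction w with
    | zero => simp
    | tmul a b => simp
    | add a b ha hb => simp only [map_add, ha, hb]
  have h2 : ((Algebra.TensorProduct.rid k k _).toAlgHom.comp
      (Algebra.TensorProduct.map (proj p k L) (uAug k L))).comp (comul k L) = proj p k L := by
    refine UniversalEnvelopingAlgebra.hom_ext k (LieHom.ext fun x => ?_)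
    change TensorProduct.rid k _ (Algebra.TensorProduct.map (proj p k L) (uAug k L)
      (comul k L (UniversalEnvelopingAlgebra.ι k x))) =
        proj p k L (UniversalEnvelopingAlgebra.ι k x)
    rw [comul_ι, map_add, Algebra.TensorProduct.map_tmul, Algebra.TensorProduct.map_tmul, uAug_ι,
      map_one, TensorProduct.tmul_zero, add_zero, TensorProduct.rid_tmul, one_smul]
  rw [h1]
  exact AlgHom.congr_fun h2 u

theorem extend_pRel (t : transgressive p k L) (u : UniversalEnvelopingAlgebra k L) (x : L) :
    extend p k L t.1.1 (u * pRel p k L x) = t.1.2 x • proj p k L u := by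
  have h : ∀ w, evalRight p k L t.1.1 (w * (pRel p k L x ⊗ₜ 1 + 1 ⊗ₜ pRel p k L x)) =
      t.1.2 x • evalRight p k L (uAug k L).toLinearMap w := by
    intro w
    induction w with
    | zero => simp
    | tmul a b =>
      rw [mul_add, Algebra.TensorProduct.tmul_mul_tmul, Algebra.TensorProduct.tmul_mul_tmul,
        map_add, evalRight_tmul, evalRight_tmul, map_mul (proj p k L), proj_pRel, mul_zero, smul_zero, zero_add,
        mul_one, transgressive_apply, evalRight_tmul, smul_smul, mul_comm]
      rfl
    | add a b ha hb => rw [add_mul, map_add, ha, hb, map_add, smul_add]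
  rw [extend, LinearMap.comp_apply, AlgHom.toLinearMap_apply, map_mul, comul_pRel, h,
    evalRight_uAug]

/-- The Hochschild two-cocycle of `u(L)` with values in `u(L)` that refines a transgressive form. -/
def hochForm (t : transgressive p k L) : RestrictedEnveloping p k L →ₗ[k]
    RestrictedEnveloping p k L →ₗ[k] RestrictedEnveloping p k L :=
  LinearMap.mk₂ k (fun a b => extend p k L t.1.1 (sect p k L a * sect p k L b) -
      a * extend p k L t.1.1 (sect p k L b) - extend p k L t.1.1 (sect p k L a) * b)
    (by intro a b c; simp only [map_add, add_mul]; abel)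
    (by intro r a b; simp only [map_smul, smul_mul_assoc, smul_sub])
    (by intro a b c; simp only [map_add, mul_add]; abel)
    (by intro r a b; simp only [map_smul, mul_smul_comm, smul_sub])

theorem hochForm_proj (t : transgressive p k L) (u v : UniversalEnvelopingAlgebra k L) :
    hochForm p k L t (proj p k L u) (proj p k L v) = extend p k L t.1.1 (u * v) -
      proj p k L u * extend p k L t.1.1 v - extend p k L t.1.1 u * proj p k L v := by
  have h1 : ∀ u ∈ restrictedIdeal p k L, ∀ v,
      extend p k L t.1.1 (u * v) = extend p k L t.1.1 u * proj p k L v := by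
    intro u hu v
    refine restrictedIdeal_induction p k L (M := fun u => extend p k L t.1.1 (u * v) =
      extend p k L t.1.1 u * proj p k L v) ?_ ?_ ?_ hu
    · simp
    · intro a b ha hb
      rw [add_mul, map_add, ha, hb, map_add, add_mul]
    · intro a x
      rw [mul_assoc, (pRel_commute p k L x v).eq, ← mul_assoc, extend_pRel, extend_pRel, map_mul,
        smul_mul_assoc]
  have h2 : ∀ v ∈ restrictedIdeal p k L, ∀ u,
      extend p k L t.1.1 (u * v) = proj p k L u * extend p k L t.1.1 v := by
    intro v hv u
    refine restrictedIdeal_induction p k L (M := fun v => extend p k L t.1.1 (u * v) =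
      proj p k L u * extend p k L t.1.1 v) ?_ ?_ ?_ hv
    · simp
    · intro a b ha hb
      rw [mul_add, map_add, ha, hb, map_add, mul_add]
    · intro a x
      rw [← mul_assoc, extend_pRel, extend_pRel, map_mul, mul_smul_comm]
  have e1 := h1 _ (sect_proj_sub p k L u) (sect p k L (proj p k L v))
  have e2 := h2 _ (sect_proj_sub p k L v) u
  simp only [sub_mul, mul_sub, map_sub, proj_sect] at e1 e2
  change extend p k L t.1.1 (sect p k L (proj p k L u) * sect p k L (proj p k L v)) -
      proj p k L u * extend p k L t.1.1 (sect p k L (proj p k L v)) -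
      extend p k L t.1.1 (sect p k L (proj p k L u)) * proj p k L v = _
  have e3 := congrArg₂ (· + ·) e1 e2
  linear_combination (norm := skip) e3
  abel

theorem hochForm_cocycle (t : transgressive p k L) (a b c : RestrictedEnveloping p k L) :
    a * hochForm p k L t b c - hochForm p k L t (a * b) c + hochForm p k L t a (b * c) -
      hochForm p k L t a b * c = 0 := by
  obtain ⟨a, rfl⟩ := proj_surjective p k L a
  obtain ⟨b, rfl⟩ := proj_surjective p k L b
  obtain ⟨c, rfl⟩ := proj_surjective p k L c
  rw [← map_mul (proj p k L), ← map_mul (proj p k L), hochForm_proj, hochForm_proj, hochForm_proj,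
    hochForm_proj, map_mul (proj p k L), map_mul (proj p k L), mul_assoc a b c]
  noncomm_ring

theorem resAug_hochForm (t : transgressive p k L) (x y : AugIdeal (resAug p k L)) :
    resAug p k L (hochForm p k L t x y) = -transForm p k L t x y := by
  have hx : resAug p k L x = 0 := x.2
  have hy : resAug p k L y = 0 := y.2
  have h := hochForm_proj p k L t (sect p k L x) (sect p k L y)
  rw [proj_sect, proj_sect] at h
  rw [h, map_sub, map_sub, map_mul (resAug p k L), map_mul (resAug p k L), resAug_extend, hx, hy, transForm_apply]
  simp

end Transgression

theorem exists_generalizedInverse {k V W : Type*} [Field k] [AddCommGroup V] [Module k V]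
    [AddCommGroup W] [Module k W] (π : V →ₗ[k] W) : ∃ s : W →ₗ[k] V, ∀ v, π (s (π v)) = π v := by
  obtain ⟨r, hr⟩ := π.rangeRestrict.exists_rightInverse_of_surjective π.range_rangeRestrict
  obtain ⟨s, hs⟩ := LinearMap.exists_extend r
  refine ⟨s, fun v => ?_⟩
  have h1 : s (π v) = r (π.rangeRestrict v) := LinearMap.congr_fun hs (π.rangeRestrict v)
  have h2 := congrArg Subtype.val (LinearMap.congr_fun hr (π.rangeRestrict v))
  rw [h1]
  exact h2

section Ring

attribute [local instance 100] LieRing.ofAssociativeRing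

open Module

variable (p : ℕ) [Fact p.Prime] (k : Type*) [Field k] [CharP k p]
variable (L : Type*) [LieRing L] [LieAlgebra k L] [FiniteDimensional k L]
  [RestrictedLieAlgebra p k L]

/-- The cohomology ring `H^*(u(L), k)`. -/
abbrev RestrictedCohomologyRing : Type _ := AugCohomology (resAug p k L)

/-- The part of `hochForm` in the augmentation ideal. -/
def hochAug (t : transgressive p k L) :
    AugIdeal (resAug p k L) →ₗ[k] AugIdeal (resAug p k L) →ₗ[k] AugIdeal (resAug p k L) :=
  augRestrict (resAug p k L)
    (hochForm p k L t - (hochForm p k L t).compr₂ ((Algebra.linearMap k _).comp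
      (resAug p k L).toLinearMap)) (fun x y => by simp)

theorem hochAug_coe (t : transgressive p k L) (x y : AugIdeal (resAug p k L)) :
    (hochAug p k L t x y : RestrictedEnveloping p k L) =
      hochForm p k L t x y + algebraMap k _ (transForm p k L t x y) := by
  change hochForm p k L t x y - algebraMap k _ (resAug p k L (hochForm p k L t x y)) = _
  rw [resAug_hochForm, map_neg, sub_neg_eq_add]

/-- The bar cochain of degree two of a transgressive form. -/
def transCochain (t : transgressive p k L) : BarCochains (resAug p k L) :=
  formElt (TensorAlgebra.ι k) (transForm p k L t)

theorem barDifferential_ι (f : Dual k (AugIdeal (resAug p k L))) :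
    (barDifferential (resAug p k L)).d (TensorAlgebra.ι k f) =
      quadMap (TensorAlgebra.ι k) (augNegMul (resAug p k L)) f :=
  tensorAntider_ι _ f

theorem transForm_assoc (t : transgressive p k L) (x y z : AugIdeal (resAug p k L)) :
    transForm p k L t (augNegMul (resAug p k L) x y) z =
      transForm p k L t x (augNegMul (resAug p k L) y z) := by
  rw [transForm_proj p k L t (augNegMul (resAug p k L) x y) z
      (-(sect p k L x * sect p k L y)) (sect p k L z) (by simp) (by simp),
    transForm_proj p k L t x (augNegMul (resAug p k L) y z)
      (sect p k L x) (-(sect p k L y * sect p k L z)) (by simp) (by simp), neg_mul, mul_neg,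
    mul_assoc]

theorem transCochain_cocycle (t : transgressive p k L) :
    transCochain p k L t ∈ (barDifferential (resAug p k L)).cocycles := by
  rw [Differential.mem_cocycles, transCochain,
    antider_formElt (TensorAlgebra.ι k) (augNegMul (resAug p k L))
      (barDifferential (resAug p k L)).sgn _ (barDifferential (resAug p k L)).d_mul
      tensorSgn_ι (barDifferential_ι p k L)]
  refine triElt_eq_zero _ _ fun x y z => ?_
  rw [transForm_assoc, sub_self]

/-- Cocycles commute with the cochains of transgressive forms up to a coboundary. -/
theorem commutator_coboundary (t : transgressive p k L) (b : BarCochains (resAug p k L))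
    (hb : (barDifferential (resAug p k L)).d b = 0) :
    ∃ z, (barDifferential (resAug p k L)).d z =
      b * transCochain p k L t - transCochain p k L t * b := by
  set d := (barDifferential (resAug p k L)).d with hd
  set D := tensorAntider (quadMap (TensorAlgebra.ι k) (hochAug p k L t)) with hD
  have hds : ∀ x, d (tensorSgn x) = -tensorSgn (d x) := (barDifferential (resAug p k L)).d_sgn
  have hss : ∀ x : BarCochains (resAug p k L), tensorSgn (tensorSgn x) = x :=
    (barDifferential (resAug p k L)).sgn_sgn
  have hdm : ∀ x y, d (x * y) = d x * y + tensorSgn x * d y :=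
    (barDifferential (resAug p k L)).d_mul
  have hDm : ∀ x y, D (x * y) = D x * y + tensorSgn x * D y := tensorAntider_mul _
  have hadj := TensorAlgebra.adjoin_range_ι (R := k) (M := Dual k (AugIdeal (resAug p k L)))
  have hDs : ∀ x, D (tensorSgn x) = -tensorSgn (D x) := fun x => by
    refine eq_of_adjoin hadj (AlgHom.id k _) tensorSgn (D.comp tensorSgn.toLinearMap)
      (-(tensorSgn.toLinearMap.comp D)) ?_ ?_ ?_ x
    · intro x y
      simp [hDm, hss]
    · intro x y
      simp [hDm, hss]
      abel
    · rintro _ ⟨f, rfl⟩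
      simp [hD, quadMap_apply, formElt_apply]
  have key : ∀ x, d (D x) + D (d x) = x * transCochain p k L t - transCochain p k L t * x := by
    intro x
    refine eq_of_adjoin hadj (AlgHom.id k _) (AlgHom.id k _) (d.comp D + D.comp d)
      (LinearMap.mulRight k (transCochain p k L t) - LinearMap.mulLeft k (transCochain p k L t))
      ?_ ?_ ?_ x
    · intro x y
      simp only [LinearMap.add_apply, LinearMap.comp_apply, hdm, hDm, map_add, hds, hDs, hss,
        AlgHom.id_apply, add_mul, mul_add, neg_mul]
      abel
    · intro x y
      simp only [LinearMap.sub_apply, LinearMap.mulRight_apply, LinearMap.mulLeft_apply,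
        AlgHom.id_apply]
      noncomm_ring
    · rintro _ ⟨f, rfl⟩
      simp only [LinearMap.add_apply, LinearMap.comp_apply, LinearMap.sub_apply,
        LinearMap.mulRight_apply, LinearMap.mulLeft_apply]
      rw [hD, tensorAntider_ι, hd, barDifferential_ι, quadMap_apply, quadMap_apply,
        antider_formElt (TensorAlgebra.ι k) (augNegMul (resAug p k L)) tensorSgn _ hdm
          tensorSgn_ι (barDifferential_ι p k L),
        antider_formElt (TensorAlgebra.ι k) (hochAug p k L t) tensorSgn _ hDm
          tensorSgn_ι (tensorAntider_ι _), transCochain, mul_formElt, formElt_mul,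
        ← sub_eq_zero, ← map_add, ← map_sub, ← map_sub]
      refine triElt_eq_zero _ _ fun x y z => ?_
      simp only [Pi.add_apply, Pi.sub_apply, LinearMap.compr₂_apply]
      have h : hochAug p k L t (augNegMul (resAug p k L) x y) z -
          hochAug p k L t x (augNegMul (resAug p k L) y z) +
          (augNegMul (resAug p k L) (hochAug p k L t x y) z -
            augNegMul (resAug p k L) x (hochAug p k L t y z)) =
          transForm p k L t y z • x - transForm p k L t x y • z := by
        refine Subtype.ext ?_
        have hc := hochForm_cocycle p k L t x y z
        simp only [Submodule.coe_add, Submodule.coe_sub, Submodule.coe_smul, augNegMul_coe,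
          hochAug_coe, Algebra.algebraMap_eq_smul_one, mul_add, add_mul, mul_smul_comm,
          smul_mul_assoc, mul_one, one_mul, map_neg, LinearMap.neg_apply]
        rw [transForm_assoc]
        linear_combination (norm := skip) hc
        abel
      have h' := congrArg f h
      simp only [map_add, map_sub, map_smul, smul_eq_mul] at h'
      rw [h']
      ring
  exact ⟨D b, by rw [← key, hb, map_zero, add_zero]⟩

/-- The bar cocycle of a transgressive form. -/
def transCocycle : transgressive p k L →ₗ[k] (barDifferential (resAug p k L)).cocycles :=
  ((formElt (TensorAlgebra.ι k)).comp (transForm p k L)).codRestrict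
    (Subalgebra.toSubmodule (barDifferential (resAug p k L)).cocycles)
    (transCochain_cocycle p k L)

theorem transCocycle_coe (t : transgressive p k L) :
    (transCocycle p k L t : BarCochains (resAug p k L)) = transCochain p k L t := rfl

theorem transCocycle_central (t : transgressive p k L) :
    (barDifferential (resAug p k L)).cls (transCocycle p k L t) ∈
      Subalgebra.center k (RestrictedCohomologyRing p k L) := by
  rw [Subalgebra.mem_center_iff]
  intro b
  obtain ⟨b, rfl⟩ := (barDifferential (resAug p k L)).cls_surjective b
  rw [← map_mul, ← map_mul, Differential.cls_eq_cls]
  exact commutator_coboundary p k L t b b.2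

/-- The class in `H^2(u(L), k)` of a transgressive form. -/
def transClass : transgressive p k L →ₗ[k] Subalgebra.center k (RestrictedCohomologyRing p k L) :=
  ((barDifferential (resAug p k L)).cls.toLinearMap.comp (transCocycle p k L)).codRestrict
    (Subalgebra.toSubmodule (Subalgebra.center k (RestrictedCohomologyRing p k L)))
    (transCocycle_central p k L)

theorem transClass_coe (t : transgressive p k L) :
    (transClass p k L t : RestrictedCohomologyRing p k L) =
      (barDifferential (resAug p k L)).cls (transCocycle p k L t) := rfl

/-- The class of a transgressive form depends only on its twisted linear form. -/
theorem transClass_eq_zero (t : transgressive p k L) (ht : t.1.2 = 0) : transClass p k L t = 0 := by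
  have hI : ∀ u ∈ restrictedIdeal p k L, t.1.1 u = 0 := by
    intro u hu
    refine restrictedIdeal_induction p k L (M := fun u => t.1.1 u = 0) ?_ ?_ ?_ hu
    · simp
    · intro a b ha hb
      rw [map_add, ha, hb, add_zero]
    · intro a x
      rw [transgressive_apply, ht]
      simp
  refine Subtype.ext ?_
  rw [transClass_coe]
  change _ = (0 : RestrictedCohomologyRing p k L)
  rw [← map_zero (barDifferential (resAug p k L)).cls, Differential.cls_eq_cls]
  refine ⟨TensorAlgebra.ι k ((t.1.1.comp (sect p k L)).comp
    (AugIdeal (resAug p k L)).subtype), ?_⟩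
  rw [barDifferential_ι, quadMap_apply, transCocycle_coe, transCochain, ZeroMemClass.coe_zero,
    sub_zero]
  refine congrArg _ (LinearMap.ext₂ fun x y => ?_)
  rw [transForm_apply]
  have h := hI _ (sect_proj_sub p k L (-(sect p k L x * sect p k L y)))
  rw [map_neg (proj p k L), map_mul (proj p k L), proj_sect, proj_sect, map_sub, sub_eq_zero] at h
  rw [← map_neg]
  exact h

/-- The projection `(Λ, f) ↦ f`. -/
def transProj : transgressive p k L →ₗ[k] TwistedDual p k L :=
  LinearMap.comp (LinearMap.snd k (Dual k (UniversalEnvelopingAlgebra k L)) (TwistedDual p k L))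
    (transgressive p k L).subtype

/-- Every twisted linear form in the image of the second projection of `transgressive` is sent to a
pair above it. -/
theorem exists_lift : ∃ s : TwistedDual p k L →ₗ[k] transgressive p k L,
    ∀ t : transgressive p k L, (s t.1.2).1.2 = t.1.2 := by
  exact exists_generalizedInverse (k := k) (V := transgressive p k L) (W := TwistedDual p k L)
    (transProj p k L)

/-- The transgression `(L^*)^(1) → H^2(u(L), k)`: a twisted linear form `f` on `L` is sent to the
class of a transgressive pair `(Λ, f)`. By the Poincaré-Birkhoff-Witt theorem every `f` belongs to
such a pair, and its class does not depend on `Λ`. -/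
def edgeOne : TwistedDual p k L →ₗ[k] Subalgebra.center k (RestrictedCohomologyRing p k L) :=
  (transClass p k L).comp (Classical.choose (exists_lift p k L))

theorem edgeOne_eq (t : transgressive p k L) : edgeOne p k L t.1.2 = transClass p k L t := by
  rw [edgeOne, LinearMap.comp_apply, ← sub_eq_zero, ← map_sub]
  refine transClass_eq_zero p k L _ ?_
  change (Classical.choose (exists_lift p k L) t.1.2).1.2 - t.1.2 = 0
  rw [Classical.choose_spec (exists_lift p k L) t, sub_self]

/-- The algebra `S^*(L^*)^(1)`. -/
abbrev TwistedSym : Type _ := SymmetricAlgebra k (TwistedDual p k L)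

/-- The edge homomorphism `S^*(L^*)^(1) → H^{2*}(u(L), k)`. -/
def symEdge : TwistedSym p k L →ₐ[k] RestrictedCohomologyRing p k L :=
  (Subalgebra.center k (RestrictedCohomologyRing p k L)).val.comp
    (SymmetricAlgebra.lift (edgeOne p k L))

theorem symEdge_commute (s : TwistedSym p k L) (h : RestrictedCohomologyRing p k L) :
    symEdge p k L s * h = h * symEdge p k L s :=
  ((Subalgebra.mem_center_iff.1 (SymmetricAlgebra.lift (edgeOne p k L) s).2) h).symm

/-- `H^*(u(L), k)` as an algebra over `S^*(L^*)^(1)`. -/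
instance : Algebra (TwistedSym p k L) (RestrictedCohomologyRing p k L) :=
  (symEdge p k L).toRingHom.toAlgebra' (symEdge_commute p k L)

theorem algebraMap_eq_symEdge (s : TwistedSym p k L) :
    algebraMap (TwistedSym p k L) (RestrictedCohomologyRing p k L) s = symEdge p k L s := rfl

instance : IsScalarTower k (TwistedSym p k L) (RestrictedCohomologyRing p k L) :=
  IsScalarTower.of_algebraMap_eq fun r => ((symEdge p k L).commutes r).symm

/-- The elements of polynomial degree `i` in `S^*(L^*)^(1)`. -/
def TwistedSym.degree (i : ℕ) : Submodule k (TwistedSym p k L) :=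
  LinearMap.range (SymmetricAlgebra.ι k (TwistedDual p k L)) ^ i

/-- The restriction of bar cochains on `u(L)` to `L`, followed by antisymmetrization. -/
def edgeCochain : BarCochains (resAug p k L) →ₐ[k] CECochains k L :=
  TensorAlgebra.lift k ((ExteriorAlgebra.ι k).comp (toAug p k L).dualMap)

theorem edgeCochain_d (hp : 3 ≤ p) (x : BarCochains (resAug p k L)) :
    edgeCochain p k L ((barDifferential (resAug p k L)).d x) =
      (ceDifferential k L).d (edgeCochain p k L x) := by
  have hx : x ∈ Algebra.adjoin k (Set.range
      (TensorAlgebra.ι k (M := Module.Dual k (AugIdeal (resAug p k L))))) := by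
    rw [TensorAlgebra.adjoin_range_ι]; trivial
  have hs : ∀ y, edgeCochain p k L ((barDifferential (resAug p k L)).sgn y) =
      (ceDifferential k L).sgn (edgeCochain p k L y) := by
    intro y
    have : (edgeCochain p k L).comp (barDifferential (resAug p k L)).sgn =
        (ceDifferential k L).sgn.comp (edgeCochain p k L) := by
      refine TensorAlgebra.hom_ext (LinearMap.ext fun f => ?_)
      change edgeCochain p k L (tensorSgn (TensorAlgebra.ι k f)) =
        extSgn (edgeCochain p k L (TensorAlgebra.ι k f))
      simp [edgeCochain]
    exact AlgHom.congr_fun this y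
  induction hx using Algebra.adjoin_induction with
  | mem x hx =>
    obtain ⟨f, rfl⟩ := hx
    have h1 : edgeCochain p k L (TensorAlgebra.ι k f) =
        ExteriorAlgebra.ι k ((toAug p k L).dualMap f) := by simp [edgeCochain]
    have h2 : ∀ g, (ceDifferential k L).d (ExteriorAlgebra.ι k g) =
        quadMap (ExteriorAlgebra.ι k) (halfBracket k L) g := fun g =>
      extAntider_ι _ (ext_quadMap_commute k L) g
    have h3 : ∀ β, edgeCochain p k L (formElt (TensorAlgebra.ι k) β) =
        formElt (ExteriorAlgebra.ι k) (β.compl₁₂ (toAug p k L) (toAug p k L)) := by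
      intro β
      rw [← formElt_comp, formElt_apply, formElt_apply]
      simp [edgeCochain]
    rw [barDifferential_ι, quadMap_apply, h3, h1, h2, quadMap_apply]
    have h2k : (2 : k) ≠ 0 := by
      have h := CharP.cast_eq_zero_iff k p 2
      rw [Nat.cast_two] at h
      rw [Ne, h]
      exact fun hd => by have := Nat.le_of_dvd two_pos hd; omega
    set δ := ((augNegMul (resAug p k L)).compr₂ f).compl₁₂ (toAug p k L) (toAug p k L) with hδ
    have h4 : (halfBracket k L).compr₂ ((toAug p k L).dualMap f) = (2 : k)⁻¹ • (δ + (-1 : k) • δ.flip) := by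
      refine LinearMap.ext₂ fun x y => ?_
      have h5 : toAug p k L ⁅x, y⁆ = -augNegMul (resAug p k L) (toAug p k L x) (toAug p k L y) +
          augNegMul (resAug p k L) (toAug p k L y) (toAug p k L x) := by
        refine Subtype.ext ?_
        rw [toAug_lie, Submodule.coe_add, Submodule.coe_neg, augNegMul_coe, augNegMul_coe, neg_neg]
        exact sub_eq_add_neg _ _
      change f (toAug p k L (halfBracket k L x y)) = (2 : k)⁻¹ •
        (f (augNegMul (resAug p k L) (toAug p k L x) (toAug p k L y)) + (-1 : k) • f (augNegMul (resAug p k L) (toAug p k L y) (toAug p k L x)))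
      rw [halfBracket_apply, map_smul, map_smul, h5, map_add, map_neg, smul_eq_mul, smul_eq_mul,
        smul_eq_mul]
      ring
    have h6 : formElt (ExteriorAlgebra.ι k : Dual k L →ₗ[k] CECochains k L) δ.flip =
        -formElt (ExteriorAlgebra.ι k) δ := by
      rw [formElt_apply, formElt_apply, Finset.sum_comm, ← Finset.sum_neg_distrib]
      refine Finset.sum_congr rfl fun a _ => ?_
      rw [← Finset.sum_neg_distrib]
      refine Finset.sum_congr rfl fun c _ => ?_
      rw [LinearMap.flip_apply, ← smul_neg]
      congr 1
      exact eq_neg_of_add_eq_zero_left (ExteriorAlgebra.ι_add_mul_swap _ _)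
    rw [h4, map_smul, map_add, map_smul, h6, neg_one_smul, neg_neg, ← two_smul k, smul_smul,
      inv_mul_cancel₀ h2k, one_smul]
  | algebraMap r =>
    simp [Algebra.algebraMap_eq_smul_one, Differential.d_one]
  | add x y _ _ hx hy => simp only [map_add, hx, hy]
  | mul x y _ _ hx hy =>
    rw [Differential.d_mul, map_add, map_mul, map_mul, map_mul, Differential.d_mul, hx, hy, hs]

/-- The edge homomorphism `H^*(u(L), k) → H^*(L, k)`. It is the map induced by `U(L) → u(L)`, where
`H^*(L, k)` is computed by the Chevalley-Eilenberg complex, to which the bar complex is compared by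
restriction of cochains to `L` and antisymmetrization. -/
def edgeMap (hp : 3 ≤ p) : RestrictedCohomologyRing p k L →ₐ[k] LieCohomology k L :=
  (barDifferential (resAug p k L)).mapCohomology (ceDifferential k L) (edgeCochain p k L)
    (edgeCochain_d p k L hp)

end Ring

end RestrictedCohomology

end

open RestrictedCohomology

set_option linter.unusedSectionVars false

/-! ### Graded algebras -/

section Graded

variable {k : Type*} [Field k] {A : Type*} [Ring A] [Algebra k A]
variable (𝓐 : ℕ → Submodule k A) [GradedAlgebra 𝓐]

namespace GradedAlgebra

/-! Write `H` for the cohomology ring of `u(n)`, `Λ` for that of `n`, and `I` for the augmentation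
ideal of `S`. Inverting `φ` on `B` gives an algebra section `Λ → H` of `φ` that need not respect
degrees. The point is to replace it by a graded one: the `S`-linear extension of a graded algebra
section is multiplicative, because `S` acts centrally, and it has the right degrees.

Bijectivity comes from the module isomorphism, which is neither graded nor tied to `φ`. Since `Λ` is
finite-dimensional, it still forces `ker φ = I H` (`mem_adicFilt_of_map_eq_zero`). Graded Nakayama
then makes the extension of any graded linear section surjective, and a surjective endomorphism of a
finite `S`-module is injective (`liftBaseChange_bijective`).

The graded section is found by averaging. A scalar `c ≠ 0` acts on `H` and `Λ` by `c ^ i` in degree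
`i`, hence by conjugation on the sections of `φ` that are multiplicative modulo `I ^ M H`. Near a
section `σ` these form an additive family to first order: if `τ` and `ρ` are congruent to `σ` modulo
`I ^ n H`, some section is congruent to `τ + ρ - σ` modulo `I ^ (n + 1) H` (`exists_isSection_add`).
So the conjugates of `σ` under a primitive `m`-th root of unity `ζ` can be added up one layer at a
time. With `m = 1` in `k` the average needs no division, and the result is `ζ`-invariant modulo `I ^
M H` (`exists_isSection_conj`).

Let `D` bound the degrees of `Λ`, and take `M = D + 1` and `m > D + 1`. Elements of `I ^ M H` have
no components below degree `2 * D + 2`, because the generators of `I` act with degree two.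
Invariance then leaves `σ x`, for `x` of degree `i`, without components below degree `i`. The
component of degree `i` is thus a leading term, and leading terms multiply; the error terms lie
beyond every degree `i + j ≤ 2 * D`. Taking leading terms gives a graded section that is exactly
multiplicative (`exists_graded_section`).

It remains to check that the cohomology rings are graded and that `φ` is a graded map that turns the
action of `S` into its augmentation. The latter holds because the cocycle of a transgressive form
`Λ` restricts on `n` to the coboundary of the restriction of `Λ`. -/

theorem proj_mem (i : ℕ) (x : A) : proj 𝓐 i x ∈ 𝓐 i := (DirectSum.decompose 𝓐 x i).2

theorem proj_of_mem {i : ℕ} {x : A} (hx : x ∈ 𝓐 i) : proj 𝓐 i x = x :=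
  DirectSum.decompose_of_mem_same 𝓐 hx

theorem proj_of_mem_ne {i j : ℕ} {x : A} (hx : x ∈ 𝓐 i) (h : i ≠ j) : proj 𝓐 j x = 0 :=
  DirectSum.decompose_of_mem_ne 𝓐 hx h

/-- A property that is closed under addition holds if it holds for homogeneous elements. -/
theorem homogeneous_induction {P : A → Prop} (h : ∀ i, ∀ x ∈ 𝓐 i, P x)
    (hadd : ∀ x y, P x → P y → P (x + y)) (x : A) : P x := by
  induction x using DirectSum.Decomposition.inductionOn 𝓐 with
  | zero => exact h 0 0 (zero_mem _)
  | homogeneous x => exact h _ _ x.2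
  | add x y hx hy => exact hadd x y hx hy

theorem linearMap_ext {M : Type*} [AddCommGroup M] [Module k M] {f g : A →ₗ[k] M}
    (h : ∀ i, ∀ x ∈ 𝓐 i, f x = g x) : f = g :=
  LinearMap.ext (homogeneous_induction 𝓐 h fun x y hx hy => by rw [map_add, map_add, hx, hy])

/-- The action of a scalar `c` on a graded algebra, `c ^ i` on the elements of degree `i`. -/
noncomputable def scale (c : k) : A →ₗ[k] A :=
  (DirectSum.toModule k ℕ A fun i => c ^ i • (𝓐 i).subtype) ∘ₗ
    (DirectSum.decomposeLinearEquiv 𝓐).toLinearMap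

theorem scale_of_mem (c : k) {i : ℕ} {x : A} (hx : x ∈ 𝓐 i) : scale 𝓐 c x = c ^ i • x := by
  lift x to 𝓐 i using hx
  simp [scale]

theorem scale_mul (c : k) (x y : A) : scale 𝓐 c (x * y) = scale 𝓐 c x * scale 𝓐 c y := by
  refine homogeneous_induction 𝓐 (P := fun x => scale 𝓐 c (x * y) = scale 𝓐 c x * scale 𝓐 c y)
    (fun i x hx => ?_) (fun x y hx hy => by rw [add_mul, map_add, hx, hy, map_add, add_mul]) x
  refine homogeneous_induction 𝓐 (P := fun y => scale 𝓐 c (x * y) = scale 𝓐 c x * scale 𝓐 c y)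
    (fun j y hy => ?_) (fun x y hx hy => by rw [mul_add, map_add, hx, hy, map_add, mul_add]) y
  rw [scale_of_mem 𝓐 c hx, scale_of_mem 𝓐 c hy, scale_of_mem 𝓐 c (SetLike.mul_mem_graded hx hy),
    smul_mul_smul_comm, pow_add]

theorem scale_one (c : k) : scale 𝓐 c 1 = 1 := by
  rw [scale_of_mem 𝓐 c SetLike.GradedOne.one_mem, pow_zero, one_smul]

theorem scale_comp_scale (c d : k) : scale 𝓐 c ∘ₗ scale 𝓐 d = scale 𝓐 (c * d) := by
  refine linearMap_ext 𝓐 fun i x hx => ?_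
  rw [LinearMap.comp_apply, scale_of_mem 𝓐 d hx, map_smul, scale_of_mem 𝓐 c hx,
    scale_of_mem 𝓐 _ hx, smul_smul, mul_pow, mul_comm]

theorem scale_one_eq_id : scale 𝓐 (1 : k) = LinearMap.id := by
  refine linearMap_ext 𝓐 fun i x hx => ?_
  rw [scale_of_mem 𝓐 _ hx, one_pow, one_smul, LinearMap.id_apply]

theorem proj_scale (c : k) (i : ℕ) (x : A) : proj 𝓐 i (scale 𝓐 c x) = c ^ i • proj 𝓐 i x := by
  refine homogeneous_induction 𝓐 (P := fun x => proj 𝓐 i (scale 𝓐 c x) = c ^ i • proj 𝓐 i x)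
    (fun j x hx => ?_) (fun x y hx hy => by rw [map_add, map_add, hx, hy, map_add, smul_add]) x
  rw [scale_of_mem 𝓐 c hx, map_smul]
  rcases eq_or_ne j i with rfl | h
  · rfl
  · rw [proj_of_mem_ne 𝓐 hx h, smul_zero, smul_zero]

/-- The elements without components of degree less than `i`. -/
def above (i : ℕ) : Submodule k A := ⨅ j : Set.Iio i, LinearMap.ker (proj 𝓐 j)

theorem mem_above {i : ℕ} {x : A} : x ∈ above 𝓐 i ↔ ∀ j < i, proj 𝓐 j x = 0 := by
  simp [above, Submodule.mem_iInf]

theorem mem_above_of_mem {i j : ℕ} (hij : i ≤ j) {x : A} (hx : x ∈ 𝓐 j) : x ∈ above 𝓐 i :=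
  (mem_above 𝓐).2 fun _ hl => proj_of_mem_ne 𝓐 hx (by omega)

theorem above_induction {i : ℕ} {P : A → Prop} (h0 : P 0) (h : ∀ j, i ≤ j → ∀ x ∈ 𝓐 j, P x)
    (hadd : ∀ x y, P x → P y → P (x + y)) {x : A} (hx : x ∈ above 𝓐 i) : P x := by
  classical
  rw [← DirectSum.sum_support_decompose 𝓐 x]
  refine Finset.sum_induction _ P hadd h0 fun j _ => ?_
  by_cases hj : j < i
  · have : (DirectSum.decompose 𝓐 x j : A) = 0 := (mem_above 𝓐).1 hx j hj
    rwa [this]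
  · exact h j (by omega) _ (proj_mem 𝓐 j x)

theorem mul_mem_above {i j : ℕ} {x y : A} (hx : x ∈ above 𝓐 i) (hy : y ∈ above 𝓐 j) :
    x * y ∈ above 𝓐 (i + j) := by
  refine above_induction 𝓐 (P := fun x => x * y ∈ above 𝓐 (i + j))
    (by rw [zero_mul]; exact zero_mem _) (fun a ha x hx => ?_)
    (fun x z hx hz => by rw [add_mul]; exact add_mem hx hz) hx
  refine above_induction 𝓐 (P := fun y => x * y ∈ above 𝓐 (i + j))
    (by rw [mul_zero]; exact zero_mem _) (fun b hb y hy => ?_)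
    (fun y z hy hz => by rw [mul_add]; exact add_mem hy hz) hy
  exact mem_above_of_mem 𝓐 (by omega) (SetLike.mul_mem_graded hx hy)

/-- Subtracting the leading component pushes a factor one step up the filtration, so the rest of the
product starts beyond degree `i + j`. This is how approximate multiplicativity becomes exact on
leading terms. -/
theorem proj_mul_of_mem_above {i j : ℕ} {x y : A} (hx : x ∈ above 𝓐 i) (hy : y ∈ above 𝓐 j) :
    proj 𝓐 (i + j) (x * y) = proj 𝓐 i x * proj 𝓐 j y := by
  have key : ∀ (l : ℕ) (z : A), z ∈ above 𝓐 l → z - proj 𝓐 l z ∈ above 𝓐 (l + 1) := by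
    intro l z hz
    refine (mem_above 𝓐).2 fun a ha => ?_
    rw [map_sub]
    rcases eq_or_ne l a with rfl | h
    · rw [proj_of_mem 𝓐 (proj_mem 𝓐 l z), sub_self]
    · rw [proj_of_mem_ne 𝓐 (proj_mem 𝓐 l z) h, (mem_above 𝓐).1 hz a (by omega), sub_zero]
  have h1 := mul_mem_above 𝓐 (key i x hx) hy
  have h2 := mul_mem_above 𝓐 (mem_above_of_mem 𝓐 le_rfl (proj_mem 𝓐 i x)) (key j y hy)
  have h1' := (mem_above 𝓐).1 h1 (i + j) (by omega)
  have h2' := (mem_above 𝓐).1 h2 (i + j) (by omega)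
  rw [sub_mul, map_sub, sub_eq_zero] at h1'
  rw [mul_sub, map_sub, sub_eq_zero] at h2'
  rw [h1', h2', proj_of_mem 𝓐 (SetLike.mul_mem_graded (proj_mem 𝓐 i x) (proj_mem 𝓐 j y))]

/-! ### Linear maps between two graded algebras. -/

variable {B : Type*} [Ring B] [Algebra k B] (𝓑 : ℕ → Submodule k B) [GradedAlgebra 𝓑]

/-- The homogeneous part of degree zero of a linear map between graded algebras, if the elements of
the source have degree at most `D`. -/
noncomputable def homogenize (D : ℕ) (σ : B →ₗ[k] A) : B →ₗ[k] A :=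
  ∑ j ∈ Finset.range (D + 1), proj 𝓐 j ∘ₗ σ ∘ₗ proj 𝓑 j

/-- The sum defining `homogenize` stops at `D`; in higher degrees both sides vanish because `x = 0`.
-/
theorem homogenize_of_mem {D : ℕ} (hD : ∀ j, D < j → 𝓑 j = ⊥) (σ : B →ₗ[k] A) {i : ℕ} {x : B}
    (hx : x ∈ 𝓑 i) : homogenize 𝓐 𝓑 D σ x = proj 𝓐 i (σ x) := by
  by_cases hi : D < i
  · rw [hD i hi, Submodule.mem_bot] at hx
    simp [hx]
  rw [homogenize, LinearMap.sum_apply, Finset.sum_eq_single i]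
  · rw [LinearMap.comp_apply, LinearMap.comp_apply, proj_of_mem 𝓑 hx]
  · intro j _ hj
    rw [LinearMap.comp_apply, LinearMap.comp_apply, proj_of_mem_ne 𝓑 hx hj.symm, map_zero, map_zero]
  · intro h
    exact absurd (Finset.mem_range.2 (by omega)) h

theorem map_proj {φ : A →ₗ[k] B} (hφ : ∀ i, ∀ x ∈ 𝓐 i, φ x ∈ 𝓑 i) (i : ℕ) (x : A) :
    φ (proj 𝓐 i x) = proj 𝓑 i (φ x) := by
  refine homogeneous_induction 𝓐 (P := fun x => φ (proj 𝓐 i x) = proj 𝓑 i (φ x))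
    (fun j x hx => ?_) (fun x y hx hy => by simp only [map_add, hx, hy]) x
  rcases eq_or_ne j i with rfl | h
  · rw [proj_of_mem 𝓐 hx, proj_of_mem 𝓑 (hφ _ _ hx)]
  · rw [proj_of_mem_ne 𝓐 hx h, proj_of_mem_ne 𝓑 (hφ _ _ hx) h, map_zero]

theorem map_scale {φ : A →ₗ[k] B} (hφ : ∀ i, ∀ x ∈ 𝓐 i, φ x ∈ 𝓑 i) (c : k) (x : A) :
    φ (scale 𝓐 c x) = scale 𝓑 c (φ x) := by
  refine homogeneous_induction 𝓐 (P := fun x => φ (scale 𝓐 c x) = scale 𝓑 c (φ x))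
    (fun j x hx => ?_) (fun x y hx hy => by simp only [map_add, hx, hy]) x
  rw [scale_of_mem 𝓐 c hx, scale_of_mem 𝓑 c (hφ _ _ hx), map_smul]

/-- The conjugate of a linear map between graded algebras by the action of a scalar. -/
noncomputable def conj (c : k) (σ : B →ₗ[k] A) : B →ₗ[k] A := scale 𝓐 c ∘ₗ σ ∘ₗ scale 𝓑 c⁻¹

theorem conj_apply (c : k) (σ : B →ₗ[k] A) (x : B) :
    conj 𝓐 𝓑 c σ x = scale 𝓐 c (σ (scale 𝓑 c⁻¹ x)) := rfl

theorem conj_conj (c d : k) (σ : B →ₗ[k] A) :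
    conj 𝓐 𝓑 c (conj 𝓐 𝓑 d σ) = conj 𝓐 𝓑 (c * d) σ := by
  have h : scale 𝓐 c ∘ₗ (scale 𝓐 d ∘ₗ σ ∘ₗ scale 𝓑 d⁻¹) ∘ₗ scale 𝓑 c⁻¹ =
      (scale 𝓐 c ∘ₗ scale 𝓐 d) ∘ₗ σ ∘ₗ (scale 𝓑 d⁻¹ ∘ₗ scale 𝓑 c⁻¹) := rfl
  rw [conj, conj, conj, h, scale_comp_scale, scale_comp_scale, mul_inv, mul_comm d⁻¹]

theorem conj_one (σ : B →ₗ[k] A) : conj 𝓐 𝓑 1 σ = σ := by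
  rw [conj, inv_one, scale_one_eq_id, scale_one_eq_id, LinearMap.id_comp, LinearMap.comp_id]

end GradedAlgebra

end Graded

/-! ### The adic filtration of an algebra -/

section Filtration

variable {S : Type*} [CommRing S] {H : Type*} [Ring H] [Algebra S H]

/-- The filtration of an algebra by the powers of an ideal of the ground ring. -/
def adicFilt (H : Type*) [Ring H] [Algebra S H] (I : Ideal S) (n : ℕ) : Submodule S H :=
  I ^ n • ⊤

variable (I : Ideal S)

theorem adicFilt_zero : adicFilt H I 0 = ⊤ := by
  rw [adicFilt, pow_zero, Ideal.one_eq_top, Submodule.top_smul]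

theorem adicFilt_anti {m n : ℕ} (h : m ≤ n) : adicFilt H I n ≤ adicFilt H I m :=
  Submodule.smul_mono_left (Ideal.pow_le_pow_right h)

theorem adicFilt_add (m n : ℕ) : adicFilt H I (m + n) = I ^ m • adicFilt H I n := by
  rw [adicFilt, adicFilt, pow_add, mul_smul]

/-- An `S`-linear map carries `I ^ n M` into `I ^ n` times its image. The shift `l` serves the
second-order estimate in `exists_isSection_add`, where a map with values in `I ^ n H` is applied to
an element of `I ^ n H`. -/
theorem map_mem_adicFilt {M : Type*} [AddCommGroup M] [Module S M] {f : M →ₗ[S] H} {l : ℕ}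
    (hf : ∀ x, f x ∈ adicFilt H I l) {n : ℕ} {x : M} (hx : x ∈ (I ^ n • ⊤ : Submodule S M)) :
    f x ∈ adicFilt H I (n + l) := by
  have h1 : f x ∈ (I ^ n • ⊤ : Submodule S M).map f := Submodule.mem_map_of_mem hx
  rw [Submodule.map_smul''] at h1
  rw [adicFilt_add]
  refine Submodule.smul_mono le_rfl (Submodule.map_le_iff_le_comap.2 ?_) h1
  exact fun y _ => hf y

theorem map_mem_adicFilt' {M : Type*} [AddCommGroup M] [Module S M] (f : M →ₗ[S] H) {n : ℕ} {x : M}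
    (hx : x ∈ (I ^ n • ⊤ : Submodule S M)) : f x ∈ adicFilt H I n :=
  map_mem_adicFilt I (l := 0) (fun x => by rw [adicFilt_zero]; trivial) hx

/-- Since `S` acts centrally, multiplication by `y` on either side is `S`-linear; the filtration
therefore consists of two-sided ideals. -/
theorem mul_mem_adicFilt {n : ℕ} {x : H} (hx : x ∈ adicFilt H I n) (y : H) :
    x * y ∈ adicFilt H I n :=
  map_mem_adicFilt' I (LinearMap.mulRight S y) hx

theorem mul_mem_adicFilt' {n : ℕ} {x : H} (y : H) (hx : x ∈ adicFilt H I n) :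
    y * x ∈ adicFilt H I n :=
  map_mem_adicFilt' I (LinearMap.mulLeft S y) hx

theorem mul_sub_mul_mem_adicFilt {n : ℕ} {x x' y y' : H} (hx : x - x' ∈ adicFilt H I n)
    (hy : y - y' ∈ adicFilt H I n) : x * y - x' * y' ∈ adicFilt H I n := by
  have h := add_mem (mul_mem_adicFilt I hx y) (mul_mem_adicFilt' I x' hy)
  rwa [sub_mul, mul_sub, sub_add_sub_cancel] at h

theorem sub_mem_trans {M : Type*} [AddCommGroup M] [Module S M] {N : Submodule S M} {x y z : M}
    (hx : x - y ∈ N) (hy : y - z ∈ N) : x - z ∈ N := by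
  simpa using add_mem hx hy

theorem sub_mem_symm {M : Type*} [AddCommGroup M] [Module S M] {N : Submodule S M} {x y : M}
    (hx : x - y ∈ N) : y - x ∈ N := by
  simpa using neg_mem hx

/-- The `n`-th power of an endomorphism with image in `I M` has image in `I ^ n M`. -/
theorem pow_apply_mem {M : Type*} [AddCommGroup M] [Module S M] {f : M →ₗ[S] M}
    (hf : ∀ x, f x ∈ (I • ⊤ : Submodule S M)) (n : ℕ) (x : M) :
    (f ^ n) x ∈ (I ^ n • ⊤ : Submodule S M) := by
  induction n with
  | zero => simp
  | succ n ih =>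
    rw [pow_succ' f, Module.End.mul_apply, pow_succ, mul_smul]
    have h1 : f ((f ^ n) x) ∈ (I ^ n • ⊤ : Submodule S M).map f := Submodule.mem_map_of_mem ih
    rw [Submodule.map_smul''] at h1
    refine Submodule.smul_mono le_rfl (Submodule.map_le_iff_le_comap.2 ?_) h1
    exact fun y _ => hf y

end Filtration

/-! ### Graded deformations -/

open GradedAlgebra

section Deformation

variable {k : Type*} [Field k] {S : Type*} [CommRing S] [Algebra k S]
variable {H : Type*} [Ring H] [Algebra k H] [Algebra S H] [IsScalarTower k S H]
variable {Λ : Type*} [Ring Λ] [Algebra k Λ]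

/-- A linear map `Λ → H` that is a section of `φ : H → Λ` and that is a homomorphism of algebras up
to elements of `I ^ M H`. -/
structure IsSection (φ : H →ₐ[k] Λ) (I : Ideal S) (M : ℕ) (σ : Λ →ₗ[k] H) : Prop where
  map_apply : ∀ x, φ (σ x) = x
  one_mem : σ 1 - 1 ∈ adicFilt H I M
  mul_mem : ∀ x y, σ (x * y) - σ x * σ y ∈ adicFilt H I M

/-- A homomorphism `φ : H → Λ` of graded algebras whose kernel is generated by the ideal of an
augmentation of `S`, where `H` is an algebra over `S`, and where this ideal is generated by a space
`V` that acts by operators of degree two. -/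
structure IsGradedDeformation (𝓗 : ℕ → Submodule k H) (𝓛 : ℕ → Submodule k Λ)
    (V : Submodule k S) (ε : S →ₐ[k] k) (φ : H →ₐ[k] Λ) : Prop where
  span_eq : Ideal.span (V : Set S) = RingHom.ker ε
  smul_mem : ∀ v ∈ V, ∀ i, ∀ x ∈ 𝓗 i, v • x ∈ 𝓗 (i + 2)
  map_mem : ∀ i, ∀ x ∈ 𝓗 i, φ x ∈ 𝓛 i
  map_smul_eq : ∀ (s : S) x, φ (s • x) = ε s • φ x
  mem_of_map_eq_zero : ∀ x, φ x = 0 → x ∈ adicFilt H (RingHom.ker ε) 1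

/-- If `H` is isomorphic to `S ⊗ Λ` as a module over `S`, a surjection `H → Λ` that is compatible with
the augmentation of `S` has the kernel generated by the augmentation ideal. -/
theorem mem_adicFilt_of_map_eq_zero [FiniteDimensional k Λ] {ε : S →ₐ[k] k} {φ : H →ₐ[k] Λ}
    (hφ : Function.Surjective φ) (hs : ∀ (s : S) x, φ (s • x) = ε s • φ x)
    (ψ : S ⊗[k] Λ ≃ₗ[S] H) (x : H) (hx : φ x = 0) : x ∈ adicFilt H (RingHom.ker ε) 1 := by
  -- The isomorphism `ψ` is not assumed compatible with `φ`. Reducing modulo the augmentation ideal,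
  -- `φ ∘ ψ` factors through `π` as an endomorphism `g` of `Λ`, surjective along with `φ` and hence
  -- injective by finite dimension. So `φ (ψ y) = 0` already gives `π y = 0`.
  let g : Λ →ₗ[k] Λ := φ.toLinearMap ∘ₗ (ψ.toLinearMap.restrictScalars k) ∘ₗ
    TensorProduct.mk k S Λ 1
  let π : S ⊗[k] Λ →ₗ[k] Λ := TensorProduct.lift ((LinearMap.lsmul k Λ).comp ε.toLinearMap)
  have hπ : ∀ y, φ (ψ y) = g (π y) := by
    intro y
    induction y with
    | zero => simp
    | add y z hy hz => simp only [map_add, hy, hz]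
    | tmul s h =>
      have h1 : s ⊗ₜ[k] h = s • (1 : S) ⊗ₜ[k] h := by
        rw [TensorProduct.smul_tmul', smul_eq_mul, mul_one]
      rw [h1, map_smul, hs, ← h1]
      change _ = g (ε s • h)
      rw [map_smul]
      rfl
  have hg : Function.Surjective g := by
    intro y
    obtain ⟨z, rfl⟩ := hφ y
    obtain ⟨w, rfl⟩ := ψ.surjective z
    exact ⟨π w, (hπ w).symm⟩
  have hg' : Function.Injective g := LinearMap.injective_iff_surjective.2 hg
  -- The kernel of `π` is `I (S ⊗ Λ)`, since `s - ε s` lies in `I` for every `s`.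
  have hker : ∀ y : S ⊗[k] Λ, y - (1 : S) ⊗ₜ π y ∈
      ((RingHom.ker ε) ^ 1 • ⊤ : Submodule S (S ⊗[k] Λ)) := by
    intro y
    induction y with
    | zero => simp
    | add y z hy hz =>
      rw [map_add, TensorProduct.tmul_add, add_sub_add_comm]
      exact add_mem hy hz
    | tmul s h =>
      change s ⊗ₜ[k] h - (1 : S) ⊗ₜ[k] (ε s • h) ∈ _
      have h1 : s ⊗ₜ[k] h - (1 : S) ⊗ₜ[k] (ε s • h) =
          (s - algebraMap k S (ε s)) • ((1 : S) ⊗ₜ[k] h) := by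
        rw [TensorProduct.smul_tmul', smul_eq_mul, mul_one, TensorProduct.sub_tmul,
          Algebra.algebraMap_eq_smul_one, TensorProduct.smul_tmul]
      rw [h1, pow_one]
      refine Submodule.smul_mem_smul ?_ trivial
      rw [RingHom.mem_ker, map_sub, AlgHom.commutes, sub_eq_zero]
      rfl
  obtain ⟨y, rfl⟩ := ψ.surjective x
  have h0 : π y = 0 := by
    rw [hπ] at hx
    exact hg' (by rw [hx, map_zero])
  have h1 := hker y
  rw [h0, TensorProduct.tmul_zero, sub_zero] at h1
  exact map_mem_adicFilt' _ ψ.toLinearMap h1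

namespace IsGradedDeformation

variable {𝓗 : ℕ → Submodule k H} [GradedAlgebra 𝓗] {𝓛 : ℕ → Submodule k Λ} [GradedAlgebra 𝓛]
variable {V : Submodule k S} {ε : S →ₐ[k] k} {φ : H →ₐ[k] Λ}

theorem map_eq_zero (hφ : IsGradedDeformation 𝓗 𝓛 V ε φ)
    {n : ℕ} (hn : 1 ≤ n) {x : H} (hx : x ∈ adicFilt H (RingHom.ker ε) n) :
    φ x = 0 := by
  have hx' := adicFilt_anti _ hn hx
  rw [adicFilt, pow_one] at hx'
  refine Submodule.smul_induction_on hx' (fun s hs y _ => ?_) (fun y z hy hz => ?_)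
  · rw [hφ.map_smul_eq, (RingHom.mem_ker).1 hs, zero_smul]
  · rw [map_add, hy, hz, add_zero]

/-- `I ^ (n + 1) H = I • I ^ n H`, and the ideal `I` is generated by `V`; the coefficients from `S`
are absorbed into `I ^ n H`. Statements about degrees can thus be checked on `V` alone, with no
grading on `S`. -/
theorem adicFilt_succ_induction (hφ : IsGradedDeformation 𝓗 𝓛 V ε φ)
    {n : ℕ} {P : H → Prop} (h0 : P 0)
    (h : ∀ v ∈ V, ∀ x ∈ adicFilt H (RingHom.ker ε) n, P (v • x))
    (hadd : ∀ x y, P x → P y → P (x + y)) {x : H} (hx : x ∈ adicFilt H (RingHom.ker ε) (n + 1)) :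
    P x := by
  rw [add_comm, adicFilt_add, pow_one] at hx
  refine Submodule.smul_induction_on hx (fun s hs y hy => ?_) hadd
  rw [← hφ.span_eq] at hs
  induction hs using Submodule.span_induction generalizing y with
  | mem v hv => exact h v hv y hy
  | zero => rwa [zero_smul]
  | add s t _ _ hs ht =>
    rw [add_smul]
    exact hadd _ _ (hs y hy) (ht y hy)
  | smul r s _ hs =>
    rw [smul_eq_mul, mul_comm, mul_smul]
    exact hs _ (Submodule.smul_mem _ _ hy)

theorem smul_mem_above (hφ : IsGradedDeformation 𝓗 𝓛 V ε φ)
    {v : S} (hv : v ∈ V) {i : ℕ} {x : H} (hx : x ∈ above 𝓗 i) :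
    v • x ∈ above 𝓗 (i + 2) := by
  refine above_induction 𝓗 (P := fun x => v • x ∈ above 𝓗 (i + 2))
    (by rw [smul_zero]; exact zero_mem _) (fun j hj x hx => ?_)
    (fun x y hx hy => by rw [smul_add]; exact add_mem hx hy) hx
  exact mem_above_of_mem 𝓗 (by omega) (hφ.smul_mem v hv j x hx)

/-- Each generator in `V` raises degrees by two. Hence an error term in a high power of `I` is
invisible in low degrees. -/
theorem adicFilt_le_above (hφ : IsGradedDeformation 𝓗 𝓛 V ε φ)
    (n : ℕ) {x : H} (hx : x ∈ adicFilt H (RingHom.ker ε) n) :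
    x ∈ above 𝓗 (2 * n) := by
  induction n generalizing x with
  | zero => exact (mem_above 𝓗).2 fun j hj => by omega
  | succ n ih =>
    refine hφ.adicFilt_succ_induction (P := fun x => x ∈ above 𝓗 (2 * (n + 1))) (zero_mem _)
      (fun v hv y hy => ?_) (fun y z hy hz => add_mem hy hz) hx
    exact hφ.smul_mem_above hv (ih hy)

theorem scale_smul (hφ : IsGradedDeformation 𝓗 𝓛 V ε φ) (c : k) {v : S} (hv : v ∈ V) (x : H) :
    scale 𝓗 c (v • x) = c ^ 2 • v • scale 𝓗 c x := by
  refine homogeneous_induction 𝓗 (P := fun x => scale 𝓗 c (v • x) = c ^ 2 • v • scale 𝓗 c x)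
    (fun i x hx => ?_) (fun x y hx hy => by simp only [smul_add, map_add, hx, hy]) x
  rw [scale_of_mem 𝓗 c (hφ.smul_mem v hv i x hx), scale_of_mem 𝓗 c hx, smul_comm v (c ^ i) x,
    smul_smul, ← pow_add, add_comm]

/-- Scaling on `H` is not `S`-linear, but by `scale_smul` it commutes with each `v ∈ V` up to the
scalar `c ^ 2`, which is enough to preserve the filtration. -/
theorem scale_mem_adicFilt (hφ : IsGradedDeformation 𝓗 𝓛 V ε φ)
    (c : k) (n : ℕ) {x : H} (hx : x ∈ adicFilt H (RingHom.ker ε) n) :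
    scale 𝓗 c x ∈ adicFilt H (RingHom.ker ε) n := by
  induction n generalizing x with
  | zero => rw [adicFilt_zero]; trivial
  | succ n ih =>
    refine hφ.adicFilt_succ_induction
      (P := fun x => scale 𝓗 c x ∈ adicFilt H (RingHom.ker ε) (n + 1)) ?_ ?_ ?_ hx
    · rw [map_zero]
      exact zero_mem _
    · intro v hv y hy
      rw [hφ.scale_smul c hv]
      refine Submodule.smul_of_tower_mem _ _ ?_
      rw [add_comm, adicFilt_add, pow_one, ← hφ.span_eq]
      refine Submodule.smul_mem_smul (Ideal.subset_span hv) ?_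
      rw [hφ.span_eq]
      exact ih hy
    · intro y z hy hz
      rw [map_add]
      exact add_mem hy hz

/-- A graded linear section of `φ` generates `H` as a module over `S`. -/
theorem liftBaseChange_surjective (hφ : IsGradedDeformation 𝓗 𝓛 V ε φ)
    {s : Λ →ₗ[k] H} (hs : ∀ i, ∀ x ∈ 𝓛 i, s x ∈ 𝓗 i)
    (hsφ : ∀ x, φ (s x) = x) : Function.Surjective (s.liftBaseChange S) := by
  suffices h : ∀ i, ∀ x ∈ 𝓗 i, x ∈ LinearMap.range (s.liftBaseChange S) from fun x =>
    homogeneous_induction 𝓗 (P := fun x => x ∈ LinearMap.range (s.liftBaseChange S)) h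
      (fun x y hx hy => add_mem hx hy) x
  intro i
  -- Graded Nakayama: modulo the image of `s`, an element of degree `i` lies in `I H`, and its part
  -- of degree `i` is a sum of terms `v • y` with `y` of degree `i - 2`.
  induction i using Nat.strong_induction_on with
  | _ i ih =>
  intro x hx
  have h1 : x - s (φ x) ∈ adicFilt H (RingHom.ker ε) (0 + 1) :=
    hφ.mem_of_map_eq_zero _ (by rw [map_sub, hsφ, sub_self])
  have h2 : proj 𝓗 i (x - s (φ x)) ∈ LinearMap.range (s.liftBaseChange S) := by
    refine hφ.adicFilt_succ_induction
      (P := fun y => proj 𝓗 i y ∈ LinearMap.range (s.liftBaseChange S)) ?_ ?_ ?_ h1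
    · rw [map_zero]
      exact zero_mem _
    · intro v hv y _
      refine homogeneous_induction 𝓗
        (P := fun y => proj 𝓗 i (v • y) ∈ LinearMap.range (s.liftBaseChange S)) ?_ ?_ y
      · intro j y hy
        rcases eq_or_ne (j + 2) i with rfl | hj
        · rw [proj_of_mem 𝓗 (hφ.smul_mem v hv j y hy)]
          exact Submodule.smul_mem _ _ (ih j (by omega) y hy)
        · rw [proj_of_mem_ne 𝓗 (hφ.smul_mem v hv j y hy) hj]
          exact zero_mem _
      · intro y z hy hz
        rw [smul_add, map_add]
        exact add_mem hy hz
    · intro y z hy hz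
      rw [map_add]
      exact add_mem hy hz
  rw [proj_of_mem 𝓗 (sub_mem hx (hs i _ (hφ.map_mem i x hx)))] at h2
  have h3 := add_mem h2 (show s (φ x) ∈ LinearMap.range (s.liftBaseChange S) from
    ⟨1 ⊗ₜ φ x, by rw [LinearMap.liftBaseChange_tmul, one_smul]⟩)
  rwa [sub_add_cancel] at h3

/-- If `H` is isomorphic to `S ⊗ Λ` as a module over `S`, a graded linear section of `φ` extends to
such an isomorphism. -/
theorem liftBaseChange_bijective (hφ : IsGradedDeformation 𝓗 𝓛 V ε φ)
    [FiniteDimensional k Λ] (ψ : S ⊗[k] Λ ≃ₗ[S] H)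
    {s : Λ →ₗ[k] H} (hs : ∀ i, ∀ x ∈ 𝓛 i, s x ∈ 𝓗 i) (hsφ : ∀ x, φ (s x) = x) :
    Function.Bijective (s.liftBaseChange S) := by
  have h := hφ.liftBaseChange_surjective hs hsφ
  refine ⟨?_, h⟩
  -- Composing with `ψ⁻¹` gives a surjective endomorphism of the finite `S`-module `S ⊗ Λ`, which is
  -- injective by the Orzech property.
  have h1 : Function.Injective (ψ.symm.toLinearMap ∘ₗ s.liftBaseChange S) :=
    OrzechProperty.injective_of_surjective_endomorphism _ (ψ.symm.surjective.comp h)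
  exact Function.Injective.of_comp (f := ψ.symm) h1

/-- Both sides send `a ⊗ x` to `ε a • x`. Thus the `S`-linear extensions of any two sections agree
modulo `ker φ`. -/
theorem map_liftBaseChange (hφ : IsGradedDeformation 𝓗 𝓛 V ε φ)
    {s : Λ →ₗ[k] H} (hsφ : ∀ x, φ (s x) = x) (t : Λ →ₗ[k] H)
    (htφ : ∀ x, φ (t x) = x) (y : S ⊗[k] Λ) :
    φ (s.liftBaseChange S y) = φ (t.liftBaseChange S y) := by
  induction y with
  | zero => simp
  | add y z hy hz => simp only [map_add, hy, hz]
  | tmul a x => rw [LinearMap.liftBaseChange_tmul, LinearMap.liftBaseChange_tmul, hφ.map_smul_eq,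
      hφ.map_smul_eq, hsφ, htφ]

/-- The `S`-linear extension of a section of `φ` is invertible modulo a power of the augmentation
ideal. -/
theorem exists_approx_inverse (hφ : IsGradedDeformation 𝓗 𝓛 V ε φ)
    {s : Λ →ₗ[k] H} (hsφ : ∀ x, φ (s x) = x)
    (hs : Function.Bijective (s.liftBaseChange S)) {σ : Λ →ₗ[k] H} (hσ : ∀ x, φ (σ x) = x) (M : ℕ) :
    ∃ β : H →ₗ[S] S ⊗[k] Λ,
      (∀ x, σ.liftBaseChange S (β x) - x ∈ adicFilt H (RingHom.ker ε) M) ∧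
      ∀ y, β (σ.liftBaseChange S y) - y ∈
        ((RingHom.ker ε) ^ M • ⊤ : Submodule S (S ⊗[k] Λ)) := by
  let θ := LinearEquiv.ofBijective _ hs
  -- Compared with the invertible extension `θ` of `s`, the extension of `σ` is `θ ∘ (1 - N)` with
  -- `N` zero modulo `I`. The truncated geometric series in `N`, followed by precomposition with
  -- `θ⁻¹`, inverts it up to `N ^ M`.
  let N : Module.End S (S ⊗[k] Λ) := 1 - θ.symm.toLinearMap ∘ₗ σ.liftBaseChange S
  have hσN : ∀ y, σ.liftBaseChange S y = θ ((1 - N) y) := by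
    intro y
    simp [N]
  have hN : ∀ y, N y ∈ (RingHom.ker ε • ⊤ : Submodule S (S ⊗[k] Λ)) := by
    intro y
    have h1 : θ (N y) ∈ adicFilt H (RingHom.ker ε) 1 := by
      refine hφ.mem_of_map_eq_zero _ ?_
      have : θ (N y) = s.liftBaseChange S y - σ.liftBaseChange S y := by
        simp [N, θ]
      rw [this, map_sub, hφ.map_liftBaseChange hsφ σ hσ, sub_self]
    have h2 : θ.symm (θ (N y)) ∈ (adicFilt H (RingHom.ker ε) 1).map θ.symm.toLinearMap :=
      Submodule.mem_map_of_mem h1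
    rw [θ.symm_apply_apply, adicFilt, pow_one, Submodule.map_smul''] at h2
    exact Submodule.smul_mono le_rfl le_top h2
  have hNM := pow_apply_mem (RingHom.ker ε) hN M
  refine ⟨(∑ i ∈ Finset.range M, N ^ i) ∘ₗ θ.symm.toLinearMap, fun x => ?_, fun y => ?_⟩
  · rw [hσN, LinearMap.comp_apply, ← Module.End.mul_apply, mul_neg_geom_sum, LinearMap.sub_apply,
      map_sub]
    have h1 : θ ((1 : Module.End S (S ⊗[k] Λ)) (θ.symm.toLinearMap x)) = x :=
      θ.apply_symm_apply x
    rw [h1, sub_sub_cancel_left]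
    exact neg_mem (map_mem_adicFilt' _ θ.toLinearMap (hNM _))
  · rw [hσN, LinearMap.comp_apply, LinearEquiv.coe_coe, θ.symm_apply_apply,
      ← Module.End.mul_apply, geom_sum_mul_neg, LinearMap.sub_apply, Module.End.one_apply,
      sub_sub_cancel_left]
    exact neg_mem (hNM _)

end IsGradedDeformation

end Deformation

/-! ### Averaging sections over roots of unity. -/

section Averaging

variable {k : Type*} [Field k] {S : Type*} [CommRing S] [Algebra k S]
variable {H : Type*} [Ring H] [Algebra k H] [Algebra S H] [IsScalarTower k S H]
variable {Λ : Type*} [Ring Λ] [Algebra k Λ]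

namespace IsGradedDeformation

variable {𝓗 : ℕ → Submodule k H} [GradedAlgebra 𝓗] {𝓛 : ℕ → Submodule k Λ} [GradedAlgebra 𝓛]
variable {V : Submodule k S} {ε : S →ₐ[k] k} {φ : H →ₐ[k] Λ}

/-- Two sections of `φ` that are congruent modulo `I ^ n H` differ by an `S`-linear endomorphism of
`H` that is multiplicative modulo `I ^ M H` and congruent to the identity modulo `I ^ n H`. -/
theorem exists_transport (hφ : IsGradedDeformation 𝓗 𝓛 V ε φ)
    {s : Λ →ₗ[k] H} (hsφ : ∀ x, φ (s x) = x)
    (hs : Function.Bijective (s.liftBaseChange S)) {M n : ℕ} (hnM : n ≤ M)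
    {σ τ : Λ →ₗ[k] H} (hσ : IsSection φ (RingHom.ker ε) M σ)
    (hτ : IsSection φ (RingHom.ker ε) M τ)
    (h : ∀ x, τ x - σ x ∈ adicFilt H (RingHom.ker ε) n) :
    ∃ α : H →ₗ[S] H, (∀ x, α (σ x) - τ x ∈ adicFilt H (RingHom.ker ε) M) ∧
      (∀ x, α x - x ∈ adicFilt H (RingHom.ker ε) n) ∧
      (∀ x y, α (x * y) - α x * α y ∈ adicFilt H (RingHom.ker ε) M) := by
  obtain ⟨β, hβ1, hβ2⟩ := hφ.exists_approx_inverse hsφ hs hσ.map_apply M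
  set I := RingHom.ker ε with hI
  have hα : ∀ y, (τ.liftBaseChange S ∘ₗ β) (σ.liftBaseChange S y) - τ.liftBaseChange S y ∈
      adicFilt H I M := by
    intro y
    rw [LinearMap.comp_apply, ← map_sub]
    exact map_mem_adicFilt' I _ (hβ2 y)
  -- The endomorphism is the `S`-linear map determined by `σ x ↦ τ x`, as far as `β` inverts the
  -- extension of `σ`.
  refine ⟨τ.liftBaseChange S ∘ₗ β, fun x => ?_, fun x => ?_, fun x y => ?_⟩
  · have h1 := hα (1 ⊗ₜ x)
    simpa only [LinearMap.liftBaseChange_tmul, one_smul] using h1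
  · refine sub_mem_trans (y := σ.liftBaseChange S (β x)) ?_ (adicFilt_anti I hnM (hβ1 x))
    rw [LinearMap.comp_apply]
    induction β x with
    | zero => simp
    | add y z hy hz =>
      rw [map_add, map_add, add_sub_add_comm]
      exact add_mem hy hz
    | tmul a y =>
      rw [LinearMap.liftBaseChange_tmul, LinearMap.liftBaseChange_tmul, ← smul_sub]
      exact Submodule.smul_mem _ _ (h y)
  · set α := τ.liftBaseChange S ∘ₗ β
    have hαM : ∀ z ∈ adicFilt H I M, α z ∈ adicFilt H I M := fun z hz => map_mem_adicFilt' I α hz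
    -- Modulo `I ^ M H` every element of `H` is in the image of the extension of `σ`, so
    -- multiplicativity need only be tested there. By `S`-bilinearity it reduces to the elements `σ
    -- u`, where both `σ` and `τ` are multiplicative modulo `I ^ M H`.
    have key : ∀ y z, α (σ.liftBaseChange S y * σ.liftBaseChange S z) -
        α (σ.liftBaseChange S y) * α (σ.liftBaseChange S z) ∈ adicFilt H I M := by
      intro y z
      induction y with
      | zero => simp
      | add y y' hy hy' =>
        simp only [map_add, add_mul]
        rw [add_sub_add_comm]
        exact add_mem hy hy'
      | tmul a u =>
      induction z with
      | zero => simp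
      | add z z' hz hz' =>
        simp only [map_add, mul_add] at hz hz' ⊢
        rw [add_sub_add_comm]
        exact add_mem hz hz'
      | tmul b v =>
        have hα1 : ∀ w, α (σ w) - τ w ∈ adicFilt H I M := fun w => by
          simpa only [LinearMap.liftBaseChange_tmul, one_smul] using hα (1 ⊗ₜ w)
        simp only [LinearMap.liftBaseChange_tmul]
        rw [map_smul α, map_smul α, smul_mul_smul_comm, smul_mul_smul_comm, map_smul α, ← smul_sub]
        refine Submodule.smul_mem _ _ ?_
        refine sub_mem_trans (y := α (σ (u * v))) ?_ ?_
        · rw [← map_sub]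
          exact hαM _ (sub_mem_symm (hσ.mul_mem u v))
        · refine sub_mem_trans (hα1 _) (sub_mem_trans (hτ.mul_mem u v) ?_)
          exact mul_sub_mul_mem_adicFilt I (sub_mem_symm (hα1 u)) (sub_mem_symm (hα1 v))
    have hx := sub_mem_symm (hβ1 x)
    have hy := sub_mem_symm (hβ1 y)
    refine sub_mem_trans ?_ (sub_mem_trans (key (β x) (β y)) ?_)
    · rw [← map_sub]
      exact hαM _ (mul_sub_mul_mem_adicFilt I hx hy)
    · refine sub_mem_symm (mul_sub_mul_mem_adicFilt I ?_ ?_)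
      · rw [← map_sub]
        exact hαM _ hx
      · rw [← map_sub]
        exact hαM _ hy

/-- The differences of a section and the sections that are congruent to it form an additive monoid
to first order. -/
theorem exists_isSection_add (hφ : IsGradedDeformation 𝓗 𝓛 V ε φ)
    {s : Λ →ₗ[k] H} (hsφ : ∀ x, φ (s x) = x)
    (hs : Function.Bijective (s.liftBaseChange S)) {M n : ℕ} (hn : 1 ≤ n) (hnM : n < M)
    {σ τ ρ : Λ →ₗ[k] H} (hσ : IsSection φ (RingHom.ker ε) M σ)
    (hτ : IsSection φ (RingHom.ker ε) M τ) (hρ : IsSection φ (RingHom.ker ε) M ρ)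
    (hτσ : ∀ x, τ x - σ x ∈ adicFilt H (RingHom.ker ε) n)
    (hρσ : ∀ x, ρ x - σ x ∈ adicFilt H (RingHom.ker ε) n) :
    ∃ χ : Λ →ₗ[k] H, IsSection φ (RingHom.ker ε) M χ ∧
      ∀ x, χ x - (τ x + ρ x - σ x) ∈ adicFilt H (RingHom.ker ε) (n + 1) := by
  obtain ⟨α, hα1, hα2, hα3⟩ := hφ.exists_transport hsφ hs hnM.le hσ hτ hτσ
  set I := RingHom.ker ε with hI
  have hαM : ∀ z ∈ adicFilt H I M, α z ∈ adicFilt H I M := fun z hz => map_mem_adicFilt' I α hz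
  -- Transporting `ρ` along the endomorphism that takes `σ` to `τ` adds the difference `τ - σ` to
  -- `ρ`, to first order.
  refine ⟨α.restrictScalars k ∘ₗ ρ, ⟨fun x => ?_, ?_, fun x y => ?_⟩, fun x => ?_⟩
  · have h1 := hφ.map_eq_zero hn (hα2 (ρ x))
    rw [map_sub, sub_eq_zero, hρ.map_apply] at h1
    exact h1
  · change α (ρ 1) - 1 ∈ _
    refine sub_mem_trans (y := α (σ 1)) ?_ (sub_mem_trans (hα1 1) hτ.one_mem)
    rw [← map_sub]
    exact hαM _ (sub_mem_trans hρ.one_mem (sub_mem_symm hσ.one_mem))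
  · change α (ρ (x * y)) - α (ρ x) * α (ρ y) ∈ _
    refine sub_mem_trans (y := α (ρ x * ρ y)) ?_ (hα3 _ _)
    rw [← map_sub]
    exact hαM _ (hρ.mul_mem x y)
  · change α (ρ x) - (τ x + ρ x - σ x) ∈ _
    -- The deviation from additivity is of second order: `α - id` has values in `I ^ n H` and is
    -- applied to an element of `I ^ n H`. As `n ≥ 1`, the result lies in `I ^ (n + 1) H`.
    have h1 : (α - LinearMap.id : H →ₗ[S] H) (ρ x - σ x) ∈ adicFilt H I (n + n) :=
      map_mem_adicFilt I (f := α - LinearMap.id) (fun y => hα2 y) (hρσ x)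
    have h2 := add_mem (adicFilt_anti I (show n + 1 ≤ n + n by omega) h1)
      (adicFilt_anti I (show n + 1 ≤ M by omega) (hα1 x))
    simp only [LinearMap.sub_apply, LinearMap.id_apply, map_sub] at h2
    convert h2 using 1
    abel

/-- Scaling is multiplicative, commutes with `φ` and preserves the filtration, so conjugation acts
on approximate sections. -/
theorem isSection_conj (hφ : IsGradedDeformation 𝓗 𝓛 V ε φ)
    {c : k} (hc : c ≠ 0) {M : ℕ} {σ : Λ →ₗ[k] H}
    (hσ : IsSection φ (RingHom.ker ε) M σ) :
    IsSection φ (RingHom.ker ε) M (conj 𝓗 𝓛 c σ) := by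
  refine ⟨fun x => ?_, ?_, fun x y => ?_⟩
  · have h1 := map_scale 𝓗 𝓛 (φ := φ.toLinearMap) hφ.map_mem c (σ (scale 𝓛 c⁻¹ x))
    rw [conj_apply]
    refine h1.trans ?_
    rw [AlgHom.toLinearMap_apply, hσ.map_apply, ← LinearMap.comp_apply, scale_comp_scale,
      mul_inv_cancel₀ hc, scale_one_eq_id, LinearMap.id_apply]
  · rw [conj_apply, scale_one]
    have h1 := hφ.scale_mem_adicFilt c M hσ.one_mem
    rwa [map_sub, scale_one] at h1
  · have h1 := hφ.scale_mem_adicFilt c M (hσ.mul_mem (scale 𝓛 c⁻¹ x) (scale 𝓛 c⁻¹ y))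
    rwa [map_sub, scale_mul, ← scale_mul 𝓛] at h1

/-- A section of `φ` can be made invariant under the action of a finite group of roots of unity,
modulo any power of the augmentation ideal. -/
theorem exists_isSection_conj (hφ : IsGradedDeformation 𝓗 𝓛 V ε φ)
    {s : Λ →ₗ[k] H} (hsφ : ∀ x, φ (s x) = x)
    (hs : Function.Bijective (s.liftBaseChange S)) {m : ℕ} (hm : (m : k) = 1) {ζ : k}
    (hζ : ζ ^ m = 1) (M : ℕ) {σ₀ : Λ →ₗ[k] H} (hσ₀ : IsSection φ (RingHom.ker ε) M σ₀) :
    ∃ σ : Λ →ₗ[k] H, IsSection φ (RingHom.ker ε) M σ ∧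
      ∀ x, conj 𝓗 𝓛 ζ σ x - σ x ∈ adicFilt H (RingHom.ker ε) M := by
  have hζ0 : ζ ≠ 0 := by
    rintro rfl
    rcases Nat.eq_zero_or_pos m with rfl | h
    · rw [Nat.cast_zero] at hm
      exact zero_ne_one hm
    · rw [zero_pow h.ne'] at hζ
      exact zero_ne_one hζ
  -- The induction starts at the first power of `I`, where invariance is automatic: two sections of
  -- `φ` differ by elements of `ker φ = I H`. For `M = 0` there is nothing to prove.
  suffices h : ∀ n, n + 1 ≤ M → ∃ σ : Λ →ₗ[k] H, IsSection φ (RingHom.ker ε) M σ ∧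
      ∀ x, conj 𝓗 𝓛 ζ σ x - σ x ∈ adicFilt H (RingHom.ker ε) (n + 1) by
    rcases M with _ | M
    · exact ⟨σ₀, hσ₀, fun x => by rw [adicFilt_zero]; trivial⟩
    · exact h M le_rfl
  intro n
  induction n with
  | zero =>
    intro _
    refine ⟨σ₀, hσ₀, fun x => hφ.mem_of_map_eq_zero _ ?_⟩
    rw [map_sub, (hφ.isSection_conj hζ0 hσ₀).map_apply, hσ₀.map_apply, sub_self]
  | succ n ih =>
    intro hn
    obtain ⟨σ, hσ, hinv⟩ := ih (by omega)
    set I := RingHom.ker ε with hI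
    -- Invariance under `ζ` modulo `I ^ (n + 1) H` passes to all powers of `ζ`, so every conjugate
    -- is close enough to `σ` for `exists_isSection_add`.
    have hpow : ∀ i, ∀ x, conj 𝓗 𝓛 (ζ ^ i) σ x - σ x ∈ adicFilt H I (n + 1) := by
      intro i
      induction i with
      | zero => intro x; rw [pow_zero, conj_one, sub_self]; exact zero_mem _
      | succ i ihi =>
        intro x
        refine sub_mem_trans ?_ (hinv x)
        rw [pow_succ', ← conj_conj, conj_apply 𝓗 𝓛 ζ, conj_apply 𝓗 𝓛 ζ, ← map_sub]
        exact hφ.scale_mem_adicFilt ζ _ (ihi _)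
    -- The differences `ζ ^ i · σ - σ` are added to `σ` one at a time, each sum being realized by a
    -- section up to `I ^ (n + 2) H`.
    have hsum : ∀ j, ∃ χ : Λ →ₗ[k] H, IsSection φ I M χ ∧
        (∀ x, χ x - σ x ∈ adicFilt H I (n + 1)) ∧
        ∀ x, χ x - (σ x + ∑ i ∈ Finset.range j, (conj 𝓗 𝓛 (ζ ^ i) σ x - σ x)) ∈
          adicFilt H I (n + 1 + 1) := by
      intro j
      induction j with
      | zero => exact ⟨σ, hσ, fun x => by simp, fun x => by simp⟩
      | succ j ihj =>
        obtain ⟨χ, hχ, hχσ, hχs⟩ := ihj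
        obtain ⟨χ', hχ', h'⟩ := hφ.exists_isSection_add hsφ hs (Nat.le_add_left 1 n) (by omega) hσ
          (hφ.isSection_conj (pow_ne_zero j hζ0) hσ) hχ (hpow j) hχσ
        refine ⟨χ', hχ', fun x => ?_, fun x => ?_⟩
        · have h1 := add_mem (add_mem (adicFilt_anti I (Nat.le_succ _) (h' x)) (hpow j x)) (hχσ x)
          convert h1 using 1
          abel
        · have h1 := add_mem (h' x) (hχs x)
          rw [Finset.sum_range_succ]
          convert h1 using 1
          abel
    obtain ⟨χ, hχ, -, hχs⟩ := hsum m
    -- Since `m = 1` in `k`, the term `-m σ` cancels `σ`, and the plain sum of the conjugates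
    -- remains.
    have hχ1 : ∀ x, χ x - ∑ i ∈ Finset.range m, conj 𝓗 𝓛 (ζ ^ i) σ x ∈
        adicFilt H I (n + 1 + 1) := by
      intro x
      have h1 := hχs x
      rwa [Finset.sum_sub_distrib, Finset.sum_const, Finset.card_range, ← Nat.cast_smul_eq_nsmul k,
        hm, one_smul, add_sub_cancel] at h1
    refine ⟨χ, hχ, fun x => ?_⟩
    refine sub_mem_trans ?_ (sub_mem_symm (hχ1 x))
    have h1 := hφ.scale_mem_adicFilt ζ _ (hχ1 (scale 𝓛 ζ⁻¹ x))
    rw [map_sub, map_sum] at h1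
    have h2 : ∀ i, scale 𝓗 ζ (conj 𝓗 𝓛 (ζ ^ i) σ (scale 𝓛 ζ⁻¹ x)) =
        conj 𝓗 𝓛 (ζ ^ (i + 1)) σ x := by
      intro i
      rw [pow_succ', ← conj_conj, conj_apply 𝓗 𝓛 ζ]
    simp only [h2] at h1
    -- Conjugating by `ζ` permutes the summands cyclically because `ζ ^ m = 1`.
    have h3 : ∑ i ∈ Finset.range m, conj 𝓗 𝓛 (ζ ^ (i + 1)) σ x =
        ∑ i ∈ Finset.range m, conj 𝓗 𝓛 (ζ ^ i) σ x := by
      have h4 := Finset.sum_range_succ' (fun i => conj 𝓗 𝓛 (ζ ^ i) σ x) m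
      rw [Finset.sum_range_succ, hζ, pow_zero] at h4
      exact (add_right_cancel h4).symm
    rw [h3] at h1
    exact h1

/-- A homomorphism `φ` that has a multiplicative section has a graded one. -/
theorem exists_graded_section (hφ : IsGradedDeformation 𝓗 𝓛 V ε φ)
    [IsAlgClosed k] (p : ℕ) [Fact p.Prime] [CharP k p] [FiniteDimensional k Λ] {D : ℕ}
    (hD : ∀ j, D < j → 𝓛 j = ⊥) (ψ : S ⊗[k] Λ ≃ₗ[S] H) (σ₀ : Λ →ₐ[k] H)
    (hσ₀ : ∀ x, φ (σ₀ x) = x) :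
    ∃ σ : Λ →ₐ[k] H, (∀ x, φ (σ x) = x) ∧ (∀ i, ∀ x ∈ 𝓛 i, σ x ∈ 𝓗 i) ∧
      Function.Bijective (σ.toLinearMap.liftBaseChange S) := by
  have hdeg : ∀ (σ : Λ →ₗ[k] H) i, ∀ x ∈ 𝓛 i, homogenize 𝓗 𝓛 D σ x ∈ 𝓗 i := by
    intro σ i x hx
    rw [homogenize_of_mem 𝓗 𝓛 hD σ hx]
    exact proj_mem 𝓗 i _
  have hsec : ∀ (σ : Λ →ₗ[k] H), (∀ x, φ (σ x) = x) → ∀ x, φ (homogenize 𝓗 𝓛 D σ x) = x := by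
    intro σ hσ
    refine homogeneous_induction 𝓛 (fun i x hx => ?_)
      (fun x y hx hy => by rw [map_add, map_add, hx, hy])
    rw [homogenize_of_mem 𝓗 𝓛 hD σ hx]
    have h1 := map_proj 𝓗 𝓛 (φ := φ.toLinearMap) hφ.map_mem i (σ x)
    refine h1.trans ?_
    rw [AlgHom.toLinearMap_apply, hσ, proj_of_mem 𝓛 hx]
  -- Homogenizing `σ₀` destroys multiplicativity but leaves a graded linear section; this suffices
  -- for an invertible reference extension.
  have hs := hφ.liftBaseChange_bijective ψ (hdeg σ₀.toLinearMap) (hsec σ₀.toLinearMap hσ₀)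
  -- This order is `1` in `k`, so that primitive `m`-th roots of unity exist and the average needs
  -- no denominator. It also exceeds `D + 1`, so that `ζ` separates the degrees up to `D`.
  let m := p * (D + 1) + 1
  have hm : (m : k) = 1 := by simp [m]
  have hm0 : NeZero (m : k) := ⟨by rw [hm]; exact one_ne_zero⟩
  obtain ⟨ζ, hζ⟩ := HasEnoughRootsOfUnity.exists_primitiveRoot k m
  have hσ₀' : IsSection φ (RingHom.ker ε) (D + 1) σ₀.toLinearMap :=
    ⟨hσ₀, by simp, fun x y => by simp⟩
  obtain ⟨σ, hσ, hinv⟩ := hφ.exists_isSection_conj (hsec σ₀.toLinearMap hσ₀) hs hm hζ.pow_eq_one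
    (D + 1) hσ₀'
  have hproj : ∀ z ∈ adicFilt H (RingHom.ker ε) (D + 1), ∀ a < 2 * (D + 1), proj 𝓗 a z = 0 :=
    fun z hz a ha => (mem_above 𝓗).1 (hφ.adicFilt_le_above _ hz) a ha
  -- For `a < i ≤ D` the invariance of `σ` multiplies the component of `σ x` in degree `a` by `ζ ^
  -- (a - i) ≠ 1` without changing it, so it vanishes. Components above degree `i` may survive and
  -- do no harm.
  have habove : ∀ i, ∀ x ∈ 𝓛 i, σ x ∈ above 𝓗 i := by
    intro i x hx
    by_cases hi : D < i
    · rw [hD i hi, Submodule.mem_bot] at hx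
      rw [hx, map_zero]
      exact zero_mem _
    refine (mem_above 𝓗).2 fun a ha => ?_
    have h1 := hproj _ (hinv x) a (by omega)
    rw [conj_apply, scale_of_mem 𝓛 _ hx, σ.map_smul, map_smul, map_sub, map_smul, proj_scale,
      smul_smul, sub_eq_zero] at h1
    by_contra h0
    have h2 : ζ⁻¹ ^ i * ζ ^ a = 1 := by
      refine smul_left_injective k h0 ?_
      simpa using h1
    have hζ0 : ζ ≠ 0 := hζ.ne_zero (Nat.succ_ne_zero _)
    have h3 : ζ ^ a = ζ ^ i := by
      rw [inv_pow] at h2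
      field_simp at h2
      exact h2
    have hDm : D + 1 < m :=
      Nat.lt_succ_of_le (Nat.le_mul_of_pos_left _ (Fact.out : p.Prime).pos)
    exact ha.ne (hζ.pow_inj (by omega) (by omega) h3)
  have hone : homogenize 𝓗 𝓛 D σ 1 = 1 := by
    rw [homogenize_of_mem 𝓗 𝓛 hD σ SetLike.GradedOne.one_mem]
    have h1 := hproj _ hσ.one_mem 0 (by omega)
    rwa [map_sub, proj_of_mem 𝓗 SetLike.GradedOne.one_mem, sub_eq_zero] at h1
  have hmul : ∀ x y, homogenize 𝓗 𝓛 D σ (x * y) =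
      homogenize 𝓗 𝓛 D σ x * homogenize 𝓗 𝓛 D σ y := by
    intro x y
    refine homogeneous_induction 𝓛 (P := fun x => homogenize 𝓗 𝓛 D σ (x * y) =
      homogenize 𝓗 𝓛 D σ x * homogenize 𝓗 𝓛 D σ y) (fun i x hx => ?_)
      (fun x z hx hz => by rw [add_mul, map_add, hx, hz, map_add, add_mul]) x
    refine homogeneous_induction 𝓛 (P := fun y => homogenize 𝓗 𝓛 D σ (x * y) =
      homogenize 𝓗 𝓛 D σ x * homogenize 𝓗 𝓛 D σ y) (fun j y hy => ?_)
      (fun y z hy hz => by rw [mul_add, map_add, hy, hz, map_add, mul_add]) y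
    by_cases hi : D < i
    · rw [hD i hi, Submodule.mem_bot] at hx
      simp [hx]
    by_cases hj : D < j
    · rw [hD j hj, Submodule.mem_bot] at hy
      simp [hy]
    -- Here `i + j ≤ 2 * D < 2 * (D + 1)`, so the multiplicativity error has no component in degree
    -- `i + j`, and the leading terms multiply exactly.
    have h1 := hproj _ (hσ.mul_mem x y) (i + j) (by omega)
    rw [map_sub, proj_mul_of_mem_above 𝓗 (habove i x hx) (habove j y hy), sub_eq_zero] at h1
    rw [homogenize_of_mem 𝓗 𝓛 hD σ (SetLike.mul_mem_graded hx hy),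
      homogenize_of_mem 𝓗 𝓛 hD σ hx, homogenize_of_mem 𝓗 𝓛 hD σ hy, h1]
  exact ⟨AlgHom.ofLinearMap (homogenize 𝓗 𝓛 D σ) hone hmul, hsec σ hσ.map_apply, hdeg σ,
    hφ.liftBaseChange_bijective ψ (hdeg σ) (hsec σ hσ.map_apply)⟩

/-- `S` is central in `H`, so the extension of a graded algebra section is itself an algebra
homomorphism; as a linear map it is the bijection already obtained. -/
theorem exists_graded_algEquiv (hφ : IsGradedDeformation 𝓗 𝓛 V ε φ)
    [IsAlgClosed k] (p : ℕ) [Fact p.Prime] [CharP k p]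
    [FiniteDimensional k Λ] {D : ℕ} (hD : ∀ j, D < j → 𝓛 j = ⊥) (ψ : S ⊗[k] Λ ≃ₗ[S] H)
    (σ₀ : Λ →ₐ[k] H) (hσ₀ : ∀ x, φ (σ₀ x) = x) :
    ∃ (σ : Λ →ₐ[k] H) (e : S ⊗[k] Λ ≃ₐ[S] H), (∀ i, ∀ x ∈ 𝓛 i, σ x ∈ 𝓗 i) ∧
      ∀ s x, e (s ⊗ₜ x) = s • σ x := by
  obtain ⟨σ, -, hσ, hbij⟩ := hφ.exists_graded_section p hD ψ σ₀ hσ₀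
  let e : S ⊗[k] Λ →ₐ[S] H :=
    Algebra.TensorProduct.lift (Algebra.ofId _ _) σ fun s x => Algebra.commutes s (σ x)
  have he : ∀ s x, e (s ⊗ₜ x) = s • σ x := fun s x => by
    rw [Algebra.smul_def]
    exact Algebra.TensorProduct.lift_tmul _ _ _ s x
  have he' : (e : S ⊗[k] Λ → H) = σ.toLinearMap.liftBaseChange S := by
    funext y
    induction y with
    | zero => rw [map_zero, map_zero]
    | add y z hy hz => rw [map_add, map_add, hy, hz]
    | tmul s x => rw [he, LinearMap.liftBaseChange_tmul]; rfl
  exact ⟨σ, AlgEquiv.ofBijective e (he' ▸ hbij), hσ, he⟩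

end IsGradedDeformation

end Averaging

/-! ### The grading of the cohomology ring -/

namespace RestrictedCohomology

namespace Differential

variable {k : Type*} [Field k] {C : Type*} [Ring C] [Algebra k C] (D : Differential k C)
variable (G : Submodule k C)

theorem mem_degreePart {m : ℕ} {x : D.Cohomology} :
    x ∈ D.degreePart G m ↔ ∃ z : D.cocycles, (z : C) ∈ G ^ m ∧ D.cls z = x := by
  rw [degreePart, Submodule.mem_map]
  rfl

instance degreePart_gradedMonoid : SetLike.GradedMonoid (D.degreePart G) where
  one_mem := (D.mem_degreePart G).2 ⟨1, by rw [pow_zero]; exact Submodule.one_le.1 le_rfl, map_one _⟩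
  mul_mem := by
    intro i j x y hx hy
    obtain ⟨z, hz, rfl⟩ := (D.mem_degreePart G).1 hx
    obtain ⟨w, hw, rfl⟩ := (D.mem_degreePart G).1 hy
    refine (D.mem_degreePart G).2 ⟨z * w, ?_, map_mul _ _ _⟩
    rw [pow_add]
    exact Submodule.mul_mem_mul hz hw

theorem d_mem_pow (hs : ∀ x ∈ G, D.sgn x = -x) (hd : ∀ x ∈ G, D.d x ∈ G ^ 2) (i : ℕ) {x : C}
    (hx : x ∈ G ^ i) : D.d x ∈ G ^ (i + 1) := by
  induction hx using Submodule.pow_induction_on_left' with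
  | algebraMap r =>
    rw [Algebra.algebraMap_eq_smul_one, map_smul, D.d_one, smul_zero]
    exact zero_mem _
  | add x y i _ _ hx hy =>
    rw [map_add]
    exact add_mem hx hy
  | mem_mul m hm i x hx ih =>
    rw [D.d_mul, hs m hm]
    refine add_mem ?_ ?_
    · rw [show i.succ + 1 = 2 + i by omega, pow_add]
      exact Submodule.mul_mem_mul (hd m hm) hx
    · rw [pow_succ' G (i + 1)]
      exact Submodule.mul_mem_mul (neg_mem hm) ih

variable [GradedAlgebra (G ^ · : ℕ → Submodule k C)]

open GradedAlgebra

theorem proj_d_zero (hs : ∀ x ∈ G, D.sgn x = -x) (hd : ∀ x ∈ G, D.d x ∈ G ^ 2) (x : C) :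
    GradedAlgebra.proj (G ^ · : ℕ → Submodule k C) 0 (D.d x) = 0 := by
  refine homogeneous_induction (G ^ · : ℕ → Submodule k C)
    (P := fun x => GradedAlgebra.proj (G ^ · : ℕ → Submodule k C) 0 (D.d x) = 0) (fun i x hx => ?_)
    (fun x y hx hy => by rw [map_add, map_add, hx, hy, add_zero]) x
  exact proj_of_mem_ne (G ^ · : ℕ → Submodule k C) (D.d_mem_pow G hs hd i hx) (Nat.succ_ne_zero i)

theorem proj_d_succ (hs : ∀ x ∈ G, D.sgn x = -x) (hd : ∀ x ∈ G, D.d x ∈ G ^ 2) (j : ℕ) (x : C) :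
    GradedAlgebra.proj (G ^ · : ℕ → Submodule k C) (j + 1) (D.d x) =
      D.d (GradedAlgebra.proj (G ^ · : ℕ → Submodule k C) j x) := by
  refine homogeneous_induction (G ^ · : ℕ → Submodule k C)
    (P := fun x => GradedAlgebra.proj (G ^ · : ℕ → Submodule k C) (j + 1) (D.d x) =
      D.d (GradedAlgebra.proj (G ^ · : ℕ → Submodule k C) j x)) (fun i x hx => ?_)
    (fun x y hx hy => by simp only [map_add, hx, hy]) x
  have h := D.d_mem_pow G hs hd i hx
  rcases eq_or_ne i j with rfl | hij
  · rw [proj_of_mem (G ^ · : ℕ → Submodule k C) hx, proj_of_mem (G ^ · : ℕ → Submodule k C) h]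
  · rw [proj_of_mem_ne (G ^ · : ℕ → Submodule k C) hx hij,
      proj_of_mem_ne (G ^ · : ℕ → Submodule k C) h (by omega), map_zero]

/-- The differential is homogeneous of degree one, so the components of a cocycle are cocycles and a
coboundary can be replaced by its component in a given degree. -/
theorem degreePart_isInternal (hs : ∀ x ∈ G, D.sgn x = -x) (hd : ∀ x ∈ G, D.d x ∈ G ^ 2) :
    DirectSum.IsInternal (D.degreePart G) := by
  classical
  rw [DirectSum.isInternal_submodule_iff_iSupIndep_and_iSup_eq_top]
  constructor
  · intro a
    rw [Submodule.disjoint_def]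
    intro x hx hx'
    obtain ⟨w, hw, rfl⟩ := (D.mem_degreePart G).1 hx
    -- A class in the sum of the other degrees has a representative `z` with no component in degree
    -- `a`. Taking the component of `w - z = d y` in degree `a` shows that `w` is a coboundary,
    -- being zero if `a = 0`.
    obtain ⟨z, hz, hzw⟩ : ∃ z : D.cocycles,
        GradedAlgebra.proj (G ^ · : ℕ → Submodule k C) a z = 0 ∧ D.cls z = D.cls w := by
      refine Submodule.iSup_induction _
        (motive := fun y => ∃ z : D.cocycles,
          GradedAlgebra.proj (G ^ · : ℕ → Submodule k C) a z = 0 ∧ D.cls z = y) hx' ?_ ?_ ?_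
      · intro b y hy
        rw [Submodule.mem_iSup] at hy
        by_cases hb : b = a
        · refine ⟨0, by simp, ?_⟩
          have h1 := hy ⊥ fun h => absurd hb h
          rw [(Submodule.mem_bot k).1 h1, map_zero]
        · have h1 := hy (D.degreePart G b) fun _ => le_rfl
          obtain ⟨z, hz, rfl⟩ := (D.mem_degreePart G).1 h1
          exact ⟨z, proj_of_mem_ne (G ^ · : ℕ → Submodule k C) hz hb, rfl⟩
      · exact ⟨0, by simp, map_zero _⟩
      · rintro y y' ⟨z, hz, rfl⟩ ⟨z', hz', rfl⟩
        exact ⟨z + z', by rw [Subalgebra.coe_add, map_add, hz, hz', add_zero], map_add _ _ _⟩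
    obtain ⟨y, hy⟩ := D.cls_eq_cls.1 hzw.symm
    have h1 : GradedAlgebra.proj (G ^ · : ℕ → Submodule k C) a (D.d y) = w := by
      rw [hy, map_sub, hz, sub_zero, proj_of_mem (G ^ · : ℕ → Submodule k C) hw]
    rw [← map_zero D.cls, D.cls_eq_cls]
    rcases a with _ | a
    · rw [D.proj_d_zero G hs hd] at h1
      exact ⟨0, by rw [← h1]; simp⟩
    · rw [D.proj_d_succ G hs hd] at h1
      exact ⟨_, by rw [h1]; simp⟩
  · rw [eq_top_iff]
    rintro x -
    obtain ⟨z, rfl⟩ := D.cls_surjective x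
    have hz : D.d (z : C) = 0 := z.2
    have hc : ∀ i, D.d (GradedAlgebra.proj (G ^ · : ℕ → Submodule k C) i z) = 0 := fun i => by
      rw [← D.proj_d_succ G hs hd, hz, map_zero]
    have hsum : z = ∑ i ∈ (DirectSum.decompose (G ^ · : ℕ → Submodule k C) (z : C)).support,
        (⟨GradedAlgebra.proj (G ^ · : ℕ → Submodule k C) i z, hc i⟩ : D.cocycles) := by
      refine Subtype.ext ?_
      rw [AddSubmonoidClass.coe_finsetSum]
      exact (DirectSum.sum_support_decompose (G ^ · : ℕ → Submodule k C) (z : C)).symm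
    rw [hsum, map_sum]
    refine Submodule.sum_mem _ fun i _ => Submodule.mem_iSup_of_mem i ?_
    exact (D.mem_degreePart G).2 ⟨_, proj_mem (G ^ · : ℕ → Submodule k C) i _, rfl⟩

/-- The cohomology ring is graded. -/
noncomputable abbrev degreePart_gradedAlgebra (hs : ∀ x ∈ G, D.sgn x = -x)
    (hd : ∀ x ∈ G, D.d x ∈ G ^ 2) : GradedAlgebra (D.degreePart G) :=
  (D.degreePart_isInternal G hs hd).gradedAlgebra

end Differential

/-! ### Gradings and finiteness of the two cohomology rings. -/

section Degrees

open Module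

variable {k : Type*} [Field k]

theorem formElt_mem_sq {V C : Type*} [AddCommGroup V] [Module k V] [FiniteDimensional k V]
    [Ring C] [Algebra k C] (j : Dual k V →ₗ[k] C) (β : V →ₗ[k] V →ₗ[k] k) :
    formElt j β ∈ LinearMap.range j ^ 2 := by
  rw [formElt_apply, pow_two]
  exact Submodule.sum_mem _ fun a _ => Submodule.sum_mem _ fun c _ => Submodule.smul_mem _ _
    (Submodule.mul_mem_mul ⟨_, rfl⟩ ⟨_, rfl⟩)

noncomputable instance augCohomology_gradedAlgebra {A : Type*} [Ring A] [Algebra k A]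
    [FiniteDimensional k A] (ε : A →ₐ[k] k) : GradedAlgebra (AugCohomology.degree ε) :=
  Differential.degreePart_gradedAlgebra (barDifferential ε) (LinearMap.range (TensorAlgebra.ι k))
    (by rintro _ ⟨f, rfl⟩; exact tensorSgn_ι f)
    (by
      rintro _ ⟨f, rfl⟩
      have h : (barDifferential ε).d (TensorAlgebra.ι k f) =
          formElt (TensorAlgebra.ι k) ((augNegMul ε).compr₂ f) := tensorAntider_ι _ f
      rw [h]
      exact formElt_mem_sq _ _)

variable (k) (L : Type*) [LieRing L] [LieAlgebra k L] [FiniteDimensional k L]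

theorem ceDifferential_ι (f : Dual k L) : (ceDifferential k L).d (ExteriorAlgebra.ι k f) =
    formElt (ExteriorAlgebra.ι k) ((halfBracket k L).compr₂ f) :=
  extAntider_ι _ (ext_quadMap_commute k L) f

noncomputable instance lieCohomology_gradedAlgebra : GradedAlgebra (LieCohomology.degree k L) :=
  haveI : GradedAlgebra (LinearMap.range (ExteriorAlgebra.ι k (M := Dual k L)) ^ · :
    ℕ → Submodule k (CECochains k L)) := ExteriorAlgebra.gradedAlgebra k (Dual k L)
  Differential.degreePart_gradedAlgebra (ceDifferential k L) (LinearMap.range (ExteriorAlgebra.ι k))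
    (by rintro _ ⟨f, rfl⟩; exact extSgn_ι f)
    (by
      rintro _ ⟨f, rfl⟩
      rw [ceDifferential_ι]
      exact formElt_mem_sq _ _)

theorem exteriorPower_eq_bot {V : Type*} [AddCommGroup V] [Module k V] [FiniteDimensional k V]
    {j : ℕ} (hj : finrank k V < j) : ⋀[k]^j V = ⊥ := by
  rw [← Submodule.finrank_eq_zero (R := k), exteriorPower.finrank_eq, Nat.choose_eq_zero_of_lt hj]

instance exteriorAlgebra_finite {V : Type*} [AddCommGroup V] [Module k V] [FiniteDimensional k V] :
    FiniteDimensional k (ExteriorAlgebra k V) := by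
  have h := (DirectSum.Decomposition.isInternal (fun i : ℕ => ⋀[k]^i V)).submodule_iSup_eq_top
  have h1 : (⨆ i : Fin (finrank k V + 1), ⋀[k]^(i : ℕ) V) = ⊤ := by
    rw [eq_top_iff, ← h]
    refine iSup_le fun i => ?_
    by_cases hi : finrank k V < i
    · rw [exteriorPower_eq_bot k hi]
      exact bot_le
    · exact le_iSup (fun i : Fin (finrank k V + 1) => ⋀[k]^(i : ℕ) V) ⟨i, by omega⟩
  refine Module.finite_def.2 ?_
  rw [← h1]
  exact Submodule.fg_iSup _ fun i => Module.Finite.iff_fg.1 inferInstance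

theorem lieCohomology_degree_eq_bot {j : ℕ} (hj : finrank k (Dual k L) < j) :
    LieCohomology.degree k L j = ⊥ := by
  rw [eq_bot_iff]
  intro x hx
  obtain ⟨z, hz, rfl⟩ := (Differential.mem_degreePart _ _).1 hx
  have h : (z : CECochains k L) ∈ ⋀[k]^j (Dual k L) := hz
  rw [exteriorPower_eq_bot k hj, Submodule.mem_bot] at h
  rw [show z = 0 from Subtype.ext h, map_zero]
  exact zero_mem _

instance lieCohomology_finite : FiniteDimensional k (LieCohomology k L) :=
  haveI : FiniteDimensional k (ceDifferential k L).cocycles :=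
    FiniteDimensional.finiteDimensional_submodule
      (Subalgebra.toSubmodule (ceDifferential k L).cocycles)
  Module.Finite.of_surjective (ceDifferential k L).cls.toLinearMap (ceDifferential k L).cls_surjective

end Degrees

end RestrictedCohomology

namespace RestrictedCohomology

/-! ### The edge homomorphisms, their degrees and their composite. -/

section Edge

open Module

attribute [local instance 100] LieRing.ofAssociativeRing

variable (p : ℕ) [Fact p.Prime] (k : Type*) [Field k] [CharP k p]
variable (L : Type*) [LieRing L] [LieAlgebra k L] [FiniteDimensional k L]
  [RestrictedLieAlgebra p k L]

theorem edgeCochain_formElt (β : AugIdeal (resAug p k L) →ₗ[k] AugIdeal (resAug p k L) →ₗ[k] k) :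
    edgeCochain p k L (formElt (TensorAlgebra.ι k) β) =
      formElt (ExteriorAlgebra.ι k) (β.compl₁₂ (toAug p k L) (toAug p k L)) := by
  rw [← formElt_comp, formElt_apply, formElt_apply]
  simp [edgeCochain]

theorem formElt_flip (β : L →ₗ[k] L →ₗ[k] k) :
    formElt (ExteriorAlgebra.ι k : Dual k L →ₗ[k] CECochains k L) β.flip =
      -formElt (ExteriorAlgebra.ι k) β := by
  rw [formElt_apply, formElt_apply, Finset.sum_comm, ← Finset.sum_neg_distrib]
  refine Finset.sum_congr rfl fun a _ => ?_
  rw [← Finset.sum_neg_distrib]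
  refine Finset.sum_congr rfl fun c _ => ?_
  rw [LinearMap.flip_apply, ← smul_neg]
  congr 1
  exact eq_neg_of_add_eq_zero_left (ExteriorAlgebra.ι_add_mul_swap _ _)

theorem two_ne_zero_of_charP (k : Type*) [Field k] {p : ℕ} [CharP k p] (hp : 3 ≤ p) :
    (2 : k) ≠ 0 := by
  have h := CharP.cast_eq_zero_iff k p 2
  rw [Nat.cast_two] at h
  rw [Ne, h]
  exact fun hd => by have := Nat.le_of_dvd two_pos hd; omega

/-- On `L`, the cocycle of a transgressive form is the coboundary of the restriction of the form. -/
theorem edgeCochain_transCochain (hp : 3 ≤ p) (t : transgressive p k L) :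
    edgeCochain p k L (transCochain p k L t) = (ceDifferential k L).d (ExteriorAlgebra.ι k
      (t.1.1.comp ((UniversalEnvelopingAlgebra.ι k : L →ₗ⁅k⁆ UniversalEnvelopingAlgebra k L) :
        L →ₗ[k] UniversalEnvelopingAlgebra k L))) := by
  rw [transCochain, edgeCochain_formElt, ceDifferential_ι]
  set δ := (transForm p k L t).compl₁₂ (toAug p k L) (toAug p k L) with hδ
  have hδ' : ∀ x y, δ x y = -t.1.1 (UniversalEnvelopingAlgebra.ι k x *
      UniversalEnvelopingAlgebra.ι k y) := fun x y =>
    transForm_proj p k L t _ _ _ _ (toAug_coe p k L x).symm (toAug_coe p k L y).symm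
  -- Antisymmetrizing `-Λ (x y)` gives `-Λ [x, y]`, the coboundary of `Λ` on `L`. The factor one
  -- half is cancelled because the flipped form contributes the same exterior element with the
  -- opposite sign.
  have h : (halfBracket k L).compr₂ (t.1.1.comp
      ((UniversalEnvelopingAlgebra.ι k : L →ₗ⁅k⁆ UniversalEnvelopingAlgebra k L) :
        L →ₗ[k] UniversalEnvelopingAlgebra k L)) = (2 : k)⁻¹ • (δ + (-1 : k) • δ.flip) := by
    refine LinearMap.ext₂ fun x y => ?_
    change t.1.1 (UniversalEnvelopingAlgebra.ι k (halfBracket k L x y)) =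
      (2 : k)⁻¹ • (δ x y + (-1 : k) • δ y x)
    rw [halfBracket_apply, map_smul (UniversalEnvelopingAlgebra.ι k), map_smul, LieHom.map_lie,
      LieRing.of_associative_ring_bracket, map_sub, hδ', hδ', smul_eq_mul, smul_eq_mul, smul_eq_mul]
    ring
  rw [h, map_smul, map_add, map_smul, formElt_flip, neg_one_smul, neg_neg, ← two_smul k, smul_smul,
    inv_mul_cancel₀ (two_ne_zero_of_charP k hp), one_smul]

theorem edgeMap_cls (hp : 3 ≤ p) (z : (barDifferential (resAug p k L)).cocycles) :
    edgeMap p k L hp ((barDifferential (resAug p k L)).cls z) =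
      (ceDifferential k L).cls ⟨edgeCochain p k L z, by
        have hz : (barDifferential (resAug p k L)).d (z : BarCochains (resAug p k L)) = 0 := z.2
        rw [Differential.mem_cocycles, ← edgeCochain_d p k L hp, hz, map_zero]⟩ := rfl

/-- Only the shape of the class matters below, so there is no need to know that the pair `t` has `f`
as its twisted form. -/
theorem edgeOne_eq_transClass (f : TwistedDual p k L) :
    ∃ t : transgressive p k L, edgeOne p k L f = transClass p k L t := ⟨_, rfl⟩

theorem edgeMap_edgeOne (hp : 3 ≤ p) (f : TwistedDual p k L) :
    edgeMap p k L hp (edgeOne p k L f) = 0 := by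
  obtain ⟨t, ht⟩ := edgeOne_eq_transClass p k L f
  rw [ht, transClass_coe, edgeMap_cls, ← map_zero (ceDifferential k L).cls, Differential.cls_eq_cls]
  exact ⟨_, (edgeCochain_transCochain p k L hp t).symm.trans (sub_zero _).symm⟩

theorem edgeOne_mem_degree (f : TwistedDual p k L) :
    (edgeOne p k L f : RestrictedCohomologyRing p k L) ∈ AugCohomology.degree (resAug p k L) 2 := by
  obtain ⟨t, ht⟩ := edgeOne_eq_transClass p k L f
  rw [ht, transClass_coe]
  exact (Differential.mem_degreePart _ _).2 ⟨_, formElt_mem_sq _ _, rfl⟩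

theorem symEdge_ι (f : TwistedDual p k L) :
    symEdge p k L (SymmetricAlgebra.ι k _ f) = edgeOne p k L f := by
  change ((SymmetricAlgebra.lift (edgeOne p k L) (SymmetricAlgebra.ι k _ f) :
    Subalgebra.center k (RestrictedCohomologyRing p k L)) : RestrictedCohomologyRing p k L) = _
  rw [SymmetricAlgebra.lift_ι_apply]

/-- Both sides are algebra homomorphisms that kill the generators: the composite of the two edge
maps is the augmentation of `S`. -/
theorem edgeMap_symEdge (hp : 3 ≤ p) (s : TwistedSym p k L) :
    edgeMap p k L hp (symEdge p k L s) = algebraMap k _ (SymmetricAlgebra.algebraMapInv s) := by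
  induction s using SymmetricAlgebra.induction with
  | algebraMap r => rw [AlgHom.commutes, AlgHom.commutes, AlgHom.commutes]; rfl
  | ι f => rw [symEdge_ι, edgeMap_edgeOne, SymmetricAlgebra.algebraMapInv_ι, map_zero]
  | add s t hs ht => simp only [map_add, hs, ht]
  | mul s t hs ht => simp only [map_mul, hs, ht]

theorem ι_smul_mem_degree (f : TwistedDual p k L) (i : ℕ) {x : RestrictedCohomologyRing p k L}
    (hx : x ∈ AugCohomology.degree (resAug p k L) i) :
    SymmetricAlgebra.ι k (TwistedDual p k L) f • x ∈
      AugCohomology.degree (resAug p k L) (i + 2) := by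
  rw [Algebra.smul_def, algebraMap_eq_symEdge, symEdge_ι, add_comm]
  exact SetLike.mul_mem_graded (edgeOne_mem_degree p k L f) hx

theorem smul_mem_degree {i j : ℕ} {s : TwistedSym p k L} (hs : s ∈ TwistedSym.degree p k L i)
    {x : RestrictedCohomologyRing p k L} (hx : x ∈ AugCohomology.degree (resAug p k L) j) :
    s • x ∈ AugCohomology.degree (resAug p k L) (2 * i + j) := by
  induction hs using Submodule.pow_induction_on_left' with
  | algebraMap r =>
    rw [algebraMap_smul, Nat.mul_zero, zero_add]
    exact Submodule.smul_mem _ _ hx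
  | add s t i _ _ hs ht =>
    rw [add_smul]
    exact add_mem hs ht
  | mem_mul v hv i s _ ih =>
    obtain ⟨f, rfl⟩ := hv
    rw [mul_smul, show 2 * i.succ + j = 2 * i + j + 2 by omega]
    exact ι_smul_mem_degree p k L f _ ih

theorem edgeMap_mem_degree (hp : 3 ≤ p) (i : ℕ) {x : RestrictedCohomologyRing p k L}
    (hx : x ∈ AugCohomology.degree (resAug p k L) i) :
    edgeMap p k L hp x ∈ LieCohomology.degree k L i := by
  obtain ⟨z, hz, rfl⟩ := (Differential.mem_degreePart _ _).1 hx
  rw [edgeMap_cls]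
  refine (Differential.mem_degreePart _ _).2 ⟨_, ?_, rfl⟩
  have h1 : (LinearMap.range (TensorAlgebra.ι k)).map (edgeCochain p k L).toLinearMap ≤
      LinearMap.range (ExteriorAlgebra.ι k) := by
    rintro _ ⟨_, ⟨f, rfl⟩, rfl⟩
    exact ⟨(toAug p k L).dualMap f, by simp [edgeCochain]⟩
  have h2 := Submodule.mem_map_of_mem (f := (edgeCochain p k L).toLinearMap) hz
  rw [Submodule.map_pow] at h2
  exact pow_le_pow_left' h1 i h2

end Edge

/-- Every `s` is congruent to its augmentation modulo the ideal of the generators; for products this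
follows from `s t - ε(s) ε(t) = (s - ε(s)) t + ε(s) (t - ε(t))`. -/
theorem span_range_symmetricAlgebra_ι (k V : Type*) [Field k] [AddCommGroup V] [Module k V] :
    Ideal.span (LinearMap.range (SymmetricAlgebra.ι k V) : Set (SymmetricAlgebra k V)) =
      RingHom.ker (SymmetricAlgebra.algebraMapInv (R := k) (M := V)) := by
  apply le_antisymm
  · refine Ideal.span_le.2 ?_
    rintro _ ⟨v, rfl⟩
    exact (RingHom.mem_ker).2 (SymmetricAlgebra.algebraMapInv_ι v)
  · have key : ∀ s : SymmetricAlgebra k V,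
        s - algebraMap k _ (SymmetricAlgebra.algebraMapInv s) ∈
          Ideal.span (LinearMap.range (SymmetricAlgebra.ι k V) : Set (SymmetricAlgebra k V)) := by
      intro s
      induction s using SymmetricAlgebra.induction with
      | algebraMap r => simp
      | ι v =>
        rw [SymmetricAlgebra.algebraMapInv_ι, map_zero, sub_zero]
        exact Ideal.subset_span ⟨v, rfl⟩
      | add s t hs ht =>
        rw [map_add, map_add, add_sub_add_comm]
        exact add_mem hs ht
      | mul s t hs ht =>
        have h := add_mem (Ideal.mul_mem_right t _ hs)
          (Ideal.mul_mem_left _ (algebraMap k _ (SymmetricAlgebra.algebraMapInv s)) ht)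
        rw [sub_mul, mul_sub, sub_add_sub_cancel] at h
        rwa [map_mul, map_mul]
    intro s hs
    have h := key s
    rwa [(RingHom.mem_ker).1 hs, map_zero, sub_zero] at h

/-! ### The cohomology ring as a graded deformation, and the main theorem. -/

section Deformation

variable (p : ℕ) [Fact p.Prime] (k : Type*) [Field k] [CharP k p]
variable (L : Type*) [LieRing L] [LieAlgebra k L] [FiniteDimensional k L]
  [RestrictedLieAlgebra p k L]

theorem edgeMap_smul (hp : 3 ≤ p) (s : TwistedSym p k L) (x : RestrictedCohomologyRing p k L) :
    edgeMap p k L hp (s • x) = SymmetricAlgebra.algebraMapInv s • edgeMap p k L hp x := by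
  rw [Algebra.smul_def, map_mul, algebraMap_eq_symEdge, edgeMap_symEdge, ← Algebra.smul_def]

theorem isGradedDeformation_edgeMap (hp : 3 ≤ p) (hs : Function.Surjective (edgeMap p k L hp))
    (ψ : TwistedSym p k L ⊗[k] LieCohomology k L ≃ₗ[TwistedSym p k L]
      RestrictedCohomologyRing p k L) :
    IsGradedDeformation (AugCohomology.degree (resAug p k L)) (LieCohomology.degree k L)
      (LinearMap.range (SymmetricAlgebra.ι k (TwistedDual p k L)))
      SymmetricAlgebra.algebraMapInv (edgeMap p k L hp) where
  span_eq := span_range_symmetricAlgebra_ι k _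
  smul_mem := by
    rintro _ ⟨f, rfl⟩ i x hx
    exact ι_smul_mem_degree p k L f i hx
  map_mem := fun i x hx => edgeMap_mem_degree p k L hp i hx
  map_smul_eq := edgeMap_smul p k L hp
  mem_of_map_eq_zero := mem_adicFilt_of_map_eq_zero hs (edgeMap_smul p k L hp) ψ

end Deformation

end RestrictedCohomology

theorem exists_section_of_bijective {k A B : Type*} [Field k] [Ring A] [Algebra k A] [Ring B]
    [Algebra k B] (φ : A →ₐ[k] B) (T : Subalgebra k A) (hT : Function.Bijective (φ.comp T.val)) :
    ∃ σ : B →ₐ[k] A, ∀ x, φ (σ x) = x :=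
  ⟨T.val.comp (AlgEquiv.ofBijective (φ.comp T.val) hT).symm.toAlgHom, fun x =>
    (AlgEquiv.ofBijective (φ.comp T.val) hT).apply_symm_apply x⟩

theorem mainTheorem3 {k : Type*} [Field k] [IsAlgClosed k] (p : ℕ) [Fact p.Prime] [CharP k p]
    (hp : 3 ≤ p) (n : Type*) [LieRing n] [LieAlgebra k n] [FiniteDimensional k n]
    [RestrictedLieAlgebra p k n]
    (hnil : ∃ N : ℕ, ∀ x : n, (pPow p k n)^[N] x = 0)
    (hmod : Nonempty (TwistedSym p k n ⊗[k] LieCohomology k n ≃ₗ[TwistedSym p k n]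
      RestrictedCohomologyRing p k n))
    (B : Subalgebra k (RestrictedCohomologyRing p k n))
    (hB : Function.Bijective ((edgeMap p k n hp).comp B.val)) :
    ∃ e : TwistedSym p k n ⊗[k] LieCohomology k n ≃ₐ[TwistedSym p k n]
        RestrictedCohomologyRing p k n,
      ∀ (i j : ℕ), ∀ s ∈ TwistedSym.degree p k n i, ∀ h ∈ LieCohomology.degree k n j,
        e (s ⊗ₜ[k] h) ∈ AugCohomology.degree (resAug p k n) (2 * i + j) := by
  obtain ⟨ψ⟩ := hmod
  obtain ⟨σ₀, hσ₀⟩ := exists_section_of_bijective (edgeMap p k n hp) B hB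
  -- The degree bound `D` is the dimension of `n*`, above which the exterior powers vanish. The
  -- section from `B` also supplies the surjectivity of `φ`.
  obtain ⟨σ, e, hσ, he⟩ := (isGradedDeformation_edgeMap p k n hp (fun x => ⟨_, hσ₀ x⟩)
    ψ).exists_graded_algEquiv p (fun j hj => lieCohomology_degree_eq_bot k n hj) ψ σ₀ hσ₀
  refine ⟨e, fun i j s hs h hh => ?_⟩
  rw [he]
  exact smul_mem_degree p k n hs (hσ j h hh)
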